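/- **Model.** Let $(V,E)$ be a finite directed graph with a destination $d\in V$, a maximal lifetime $L$ with lifetime set $\mathcal L=\{1,\dots,L\}$, average link capacities $C_{ij}\in\mathbb R$, link costs $e_{ij}\in\mathbb R$ for $(i,j)\in E$, and an initial backlog of finitely many packets (none at $d$). An arrival vector is $\lambda=(\lambda_i^{(l)})_{i\in V,\,l\in\mathcal L}$ with $\lambda_i^{(l)}\ge 0$ and $\lambda_d^{(l)}=0$; $\|\lambda\|_1=\sum_{i,l}\lambda_i^{(l)}$. For every $\lambda$ fix an arrival process: the numbers $a_i^{(l)}(t)$ of arriving packets are nonnegative integers, bounded, i.i.d. over $t=0,1,2,\dots$ (arbitrarily dependent over $i,l$), with mean $\lambda_i^{(l)}$. For an array $x=(x_{ij}^{(l)})$ put $x_{ij}=\sum_l x_{ij}^{(l)}$, $x_{i\to}^{(l)}=\sum_{j:(i,j)\in E}x_{ij}^{(l)}$, $x_{\to i}^{(l)}=\sum_{j:(j,i)\in E}x_{ji}^{(l)}$, $x_{\to d}=\sum_l x_{\to d}^{(l)}$, and let the superscript $(\ge l)$ denote summation over all lifetimes $\ell\in\mathcal L$, $\ell\ge l$.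 Write $\overline{z(t)}=\lim_{T\to\infty}\frac1T\sum_{t=0}^{T-1}z(t)$. A policy chooses, in each slot $t$, real numbers $x(t)=(x_{ij}^{(l)}(t))_{(i,j)\in E,\,l\in\mathcal L}$ as a measurable function of the arrivals in the slots before $t$ and of a random seed independent of the arrivals. A policy is admissible for a problem at $(\lambda,\gamma)$, $\gamma\in\mathbb R$, if $x(t)\ge0$ for all $t$, the averages named in the constraints exist, and the constraints hold (pathwise constraints almost surely): * $\mathscr P_1$ (lifetime-queue problem): $\overline{\mathbb E\,x_{\to d}(t)}\ge\gamma\|\lambda\|_1$; $\overline{\mathbb E\,x_{ij}(t)}\le C_{ij}$ for $(i,j)\in E$; and $x_{i\to}^{(l)}(t)\le Q_i^{(l)}(t)$ for all $i,l,t$, where $Q_d^{(l)}(t)=0$ and, for $i\ne d$, $Q_i^{(l)}(t+1)=Q_i^{(l+1)}(t)-x_{i\to}^{(l+1)}(t)+x_{\to i}^{(l+1)}(t)+a_i^{(l)}(t)$ (terms of lifetime $L+1$ are $0$; packets reaching lifetime $0$ are dropped), started from the given initial backlog. * $\mathscr P_2$ (relaxed virtual-network problem): $\overline{\mathbb E\,x_{\to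 d}(t)}\ge\gamma\|\lambda\|_1$; $x_{ij}(t)\le C_{ij}$ for $(i,j)\in E$ and all $t$; $\overline{\mathbb E\,x_{i\to}^{(\ge l)}(t)}\le\overline{\mathbb E\,x_{\to i}^{(\ge l+1)}(t)}+\lambda_i^{(\ge l)}$ for all $i,l$; and $x_{dk}^{(l)}(t)=0$ for $(d,k)\in E$ and all $l,t$ (the destination sends nothing). The capacity region $\Lambda_n$ is the set of pairs $(\lambda,\gamma)$ at which $\mathscr P_n$ has an admissible policy. The average cost of a policy is $\overline{\mathbb E\sum_{(i,j)\in E}e_{ij}x_{ij}(t)}$ where this exists, and its flow assignment is the array of the $\overline{\mathbb E\,x_{ij}^{(l)}(t)}$. **Proposition.** 1. $\Lambda_1=\Lambda_2$. 2. For $n=1,2$: $(\lambda,\gamma)\in\Lambda_n$ if and only if there is $x=(x_{ij}^{(l)})_{(i,j)\in E,\,l\in\mathcal L}$, $x_{ij}^{(l)}\ge0$, with, for all $i\in V$, $(i,j)\in E$, $l\in\mathcal L$ and $(d,k)\in E$, $$x_{\to d}\ge\gamma\|\lambda\|_1,\qquad x_{ij}\le C_{ij},\qquad x_{\to i}^{(\ge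 l+1)}+\lambda_i^{(\ge l)}\ge x_{i\to}^{(\ge l)},\qquad x_{dk}^{(l)}=0$$ (there are no flows of lifetime $0$). 3. For every $x$ as in 2, the following stationary randomized policy is well defined, admissible for $\mathscr P_1$ at $(\lambda,\gamma)$, and has flow assignment $x$: in each slot every packet of lifetime $l$ at node $i$ is, independently, sent along $(i,j)\in E$ to $j$ with probability $$\alpha_i^{(l)}(j)=\frac{x_{ij}^{(l)}}{x_{\to i}^{(\ge l+1)}+\lambda_i^{(\ge l)}-x_{i\to}^{(\ge l+1)}}$$ (read as $0$ if the denominator is $0$), and stays at $i$ otherwise. 4. For every $(\lambda,\gamma)\in\Lambda_1=\Lambda_2$ there is an $x$ as in 2 whose policy from 3, which is admissible for $\mathscr P_1$, has an average cost that is the minimum of the average costs of all admissible policies of $\mathscr P_1$, and also of those of $\mathscr P_2$. -/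

import Mathlib

open Filter Topology MeasureTheory

universe u

noncomputable section

/-- A packet routing network: a directed graph `(V, E)`, the destination `d` of the commodity, the
maximal lifetime `L`, the average link capacities `C i j` and the link costs `e i j` (both only
meaningful for `(i, j) ∈ E`), and the numbers of packets that are in the network at time `0`
(none of them at the destination). -/
structure Network (V : Type u) where
  E : Finset (V × V)
  d : V
  L : ℕ
  C : V → V → ℝ
  e : V → V → ℝ
  init : V → Finset.Icc 1 L → ℕ
  init_d : ∀ l, init d l = 0

namespace Network

variable {V : Type u}

/-- The set of lifetimes `{1, …, L}`. A packet of lifetime `0` is outdated and is dropped, so there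
are no flow variables and no queues of lifetime `0`. -/
abbrev Lifetime (N : Network V) : Type := Finset.Icc 1 N.L

/-- A link-and-lifetime indexed array `x i j l`; only the entries with `(i, j) ∈ E` matter. -/
abbrev Flow (N : Network V) (R : Type) : Type u := V → V → N.Lifetime → R

/-- Numbers `a i l` of lifetime-`l` packets that arrive at node `i` in one time slot. -/
abbrev Arrivals (N : Network V) : Type u := V → N.Lifetime → ℕ

/-- Arrival vectors: nonnegative mean rates; no packets originate at the destination. -/
def ArrivalVector (N : Network V) : Type u :=
  {lam : V → N.Lifetime → ℝ // (∀ i l, 0 ≤ lam i l) ∧ ∀ l, lam N.d l = 0}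

/-- The law of the arrivals in one time slot: bounded, with mean `lam`. Dependence between the
arrivals at different nodes or of different lifetimes is allowed. -/
structure ArrivalLaw (N : Network V) (lam : N.ArrivalVector) where
  law : Measure N.Arrivals
  isProb : IsProbabilityMeasure law
  bounded : ∃ A : ℕ, ∀ᵐ a ∂law, ∀ i l, a i l ≤ A
  mean : ∀ i l, ∫ a, (a i l : ℝ) ∂law = lam.1 i l

section Aggregates

variable (N : Network V) {R : Type} [AddCommMonoid R]

/-- `z^{(≥ l)}`. -/
def sumGE (z : N.Lifetime → R) (l : N.Lifetime) : R := ∑ m with l ≤ m, z m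

/-- `z^{(≥ l + 1)}`. -/
def sumGT (z : N.Lifetime → R) (l : N.Lifetime) : R := ∑ m with l < m, z m

/-- `z^{(l + 1)}`, which is `0` for `l = L`. -/
def next (z : N.Lifetime → R) (l : N.Lifetime) : R :=
  if h : l.1 + 1 ≤ N.L then z ⟨l.1 + 1, Finset.mem_Icc.2 ⟨Nat.le_add_left 1 l.1, h⟩⟩ else 0

/-- Total flow `x i j` on a link, over all lifetimes. -/
def linkFlow (x : N.Flow R) (i j : V) : R := ∑ l, x i j l

/-- The cost of a decision. -/
def cost (x : N.Flow ℝ) : ℝ := ∑ p ∈ N.E, N.e p.1 p.2 * N.linkFlow x p.1 p.2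

variable [Fintype V]

/-- The total arrival rate, that is, the `ℓ¹`-norm of the arrival vector. -/
def totalRate (lam : N.ArrivalVector) : ℝ := ∑ i, ∑ l, lam.1 i l

variable [DecidableEq V]

/-- `δ⁺`, the set of heads of the outgoing links of `i`. -/
def outN (i : V) : Finset V := {j | (i, j) ∈ N.E}

/-- `δ⁻`, the set of tails of the incoming links of `i`. -/
def inN (i : V) : Finset V := {j | (j, i) ∈ N.E}

/-- Outgoing flow of lifetime `l`. -/
def outFlow (x : N.Flow R) (i : V) (l : N.Lifetime) : R := ∑ j ∈ N.outN i, x i j l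

/-- Incoming flow of lifetime `l`. -/
def inFlow (x : N.Flow R) (i : V) (l : N.Lifetime) : R := ∑ j ∈ N.inN i, x j i l

/-- The flow into the destination, over all lifetimes. -/
def delivered (x : N.Flow R) : R := ∑ l, N.inFlow x N.d l

/-- One step of the queuing dynamics, with backlogs `q`, transmitted packets `x` and exogenous
arrivals `a`. Packets of lifetime `1` that are not sent are dropped, and the destination consumes
its packets at once. It is used for `R = ℝ` and, for integer numbers of packets, for `R = ℕ`. -/
def queueStep [Sub R] (q : V → N.Lifetime → R) (x : N.Flow R) (a : V → N.Lifetime → R) :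
    V → N.Lifetime → R := fun i l =>
  if i = N.d then 0
  else N.next (fun m => q i m - N.outFlow x i m + N.inFlow x i m) l + a i l

/-- The backlogs `Q i l` at time `t` under the decisions `x 0, x 1, …` and arrivals
`a 0, a 1, …`. -/
def queue (x : ℕ → N.Flow ℝ) (a : ℕ → N.Arrivals) : ℕ → V → N.Lifetime → ℝ
  | 0 => fun i l => N.init i l
  | t + 1 => N.queueStep (queue x a t) (x t) (fun i l => a t i l)

end Aggregates

/-- A (possibly randomized, possibly history dependent) control policy. The decisions of slot `t`
are a function of the arrivals before slot `t` and of a random seed that is independent of the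
arrivals; past decisions and backlogs are functions of the same data. -/
structure Policy (N : Network V) where
  Seed : Type u
  seedSpace : MeasurableSpace Seed
  seedLaw : Measure Seed
  isProb : IsProbabilityMeasure seedLaw
  x : ℕ → (ℕ → N.Arrivals) → Seed → N.Flow ℝ
  measurable_x : ∀ t i j l,
    Measurable fun ω : (ℕ → N.Arrivals) × Seed => x t ω.1 ω.2 i j l
  causal : ∀ t a a' s, (∀ τ < t, a τ = a' τ) → x t a s = x t a' s

attribute [instance] Policy.seedSpace Policy.isProb ArrivalLaw.isProb

section Problems

variable {N : Network V} {lam : N.ArrivalVector}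

/-- The joint law of the arrival process, i.i.d. over time, and of the seed of the policy. -/
def Policy.prob (p : N.Policy) (D : N.ArrivalLaw lam) : Measure ((ℕ → N.Arrivals) × p.Seed) :=
  (Measure.infinitePi fun _ : ℕ => D.law).prod p.seedLaw

/-- The expectation of a function `g` of the decision at time `t`. -/
def Policy.expect (p : N.Policy) (D : N.ArrivalLaw lam) (g : N.Flow ℝ → ℝ) (t : ℕ) : ℝ :=
  ∫ ω, g (p.x t ω.1 ω.2) ∂p.prob D

/-- The long-term average of `z 0, z 1, …` exists and equals `m`. -/
def HasAvg (z : ℕ → ℝ) (m : ℝ) : Prop :=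
  Tendsto (fun T : ℕ => (1 / (T : ℝ)) * ∑ t ∈ Finset.range T, z t) atTop (𝓝 m)

/-- `f` is the flow assignment of the policy. -/
def Policy.HasFlow (p : N.Policy) (D : N.ArrivalLaw lam) (f : N.Flow ℝ) : Prop :=
  ∀ i j, (i, j) ∈ N.E → ∀ l, HasAvg (p.expect D fun x => x i j l) (f i j l)

variable [Fintype V] [DecidableEq V]

/-- `c` is the expected long-term average cost of the policy. -/
def Policy.HasCost (p : N.Policy) (D : N.ArrivalLaw lam) (c : ℝ) : Prop :=
  HasAvg (p.expect D N.cost) c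

/-- Admissibility for the original lifetime-queue problem. (Under `nonneg` and `available` the
decisions of each slot are bounded, so that all expectations are those of integrable variables.) -/
structure Policy.Admissible₁ (p : N.Policy) (D : N.ArrivalLaw lam) (γ : ℝ) : Prop where
  nonneg : ∀ᵐ ω ∂p.prob D, ∀ t i j, (i, j) ∈ N.E → ∀ l, 0 ≤ p.x t ω.1 ω.2 i j l
  reliable : ∃ m, HasAvg (p.expect D N.delivered) m ∧ γ * N.totalRate lam ≤ m
  capacity : ∀ i j, (i, j) ∈ N.E →
    ∃ m, HasAvg (p.expect D fun x => N.linkFlow x i j) m ∧ m ≤ N.C i j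
  available : ∀ᵐ ω ∂p.prob D, ∀ t i l,
    N.outFlow (p.x t ω.1 ω.2) i l ≤ N.queue (fun τ => p.x τ ω.1 ω.2) ω.1 t i l

/-- Admissibility for the relaxed virtual-network problem. The destination consumes the packets it
receives, so it does not send any. (Under `nonneg` and `capacity` the decisions are bounded.) -/
structure Policy.Admissible₂ (p : N.Policy) (D : N.ArrivalLaw lam) (γ : ℝ) : Prop where
  nonneg : ∀ᵐ ω ∂p.prob D, ∀ t i j, (i, j) ∈ N.E → ∀ l, 0 ≤ p.x t ω.1 ω.2 i j l
  boundary : ∀ᵐ ω ∂p.prob D, ∀ t k, (N.d, k) ∈ N.E → ∀ l, p.x t ω.1 ω.2 N.d k l = 0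
  reliable : ∃ m, HasAvg (p.expect D N.delivered) m ∧ γ * N.totalRate lam ≤ m
  capacity : ∀ᵐ ω ∂p.prob D, ∀ t i j, (i, j) ∈ N.E →
    N.linkFlow (p.x t ω.1 ω.2) i j ≤ N.C i j
  causality : ∀ i l, ∃ m m',
    HasAvg (p.expect D fun x => N.sumGE (N.outFlow x i) l) m ∧
    HasAvg (p.expect D fun x => N.sumGT (N.inFlow x i) l) m' ∧
    m ≤ m' + N.sumGE (lam.1 i) l

end Problems

section Regions

variable [Fintype V] [DecidableEq V] (N : Network V)

/-- The capacity region of the original problem, the arrivals with mean `lam` having the law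
`D lam` in each slot. -/
def capacityRegion₁ (D : ∀ lam : N.ArrivalVector, N.ArrivalLaw lam) :
    Set (N.ArrivalVector × ℝ) :=
  {q | ∃ p : N.Policy, p.Admissible₁ (D q.1) q.2}

/-- The capacity region of the virtual-network problem. -/
def capacityRegion₂ (D : ∀ lam : N.ArrivalVector, N.ArrivalLaw lam) :
    Set (N.ArrivalVector × ℝ) :=
  {q | ∃ p : N.Policy, p.Admissible₂ (D q.1) q.2}

/-- The average costs of the admissible policies of the original problem. -/
def costs₁ {lam : N.ArrivalVector} (D : N.ArrivalLaw lam) (γ : ℝ) : Set ℝ :=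
  {c | ∃ p : N.Policy, p.Admissible₁ D γ ∧ p.HasCost D c}

/-- The average costs of the admissible policies of the virtual-network problem. -/
def costs₂ {lam : N.ArrivalVector} (D : N.ArrivalLaw lam) (γ : ℝ) : Set ℝ :=
  {c | ∃ p : N.Policy, p.Admissible₂ D γ ∧ p.HasCost D c}

/-- The four conditions on the per-lifetime link flows. (The boundary condition on flows of
lifetime `0` is built into the index set of the lifetimes.) -/
structure FlowConditions (lam : N.ArrivalVector) (γ : ℝ) (x : N.Flow ℝ) : Prop where
  nonneg : ∀ i j, (i, j) ∈ N.E → ∀ l, 0 ≤ x i j l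
  reliable : γ * N.totalRate lam ≤ N.delivered x
  capacity : ∀ i j, (i, j) ∈ N.E → N.linkFlow x i j ≤ N.C i j
  conservation : ∀ i l,
    N.sumGE (N.outFlow x i) l ≤ N.sumGT (N.inFlow x i) l + N.sumGE (lam.1 i) l
  boundary : ∀ k, (N.d, k) ∈ N.E → ∀ l, x N.d k l = 0

/-- The forwarding probabilities `α i l j` determined by a flow (read as `0` if the denominator
vanishes, in which case the numerator vanishes for flows that satisfy the conditions above). -/
def alpha (lam : N.ArrivalVector) (x : N.Flow ℝ) (i : V) (l : N.Lifetime) (j : V) : ℝ :=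
  x i j l /
    (N.sumGT (N.inFlow x i) l + N.sumGE (lam.1 i) l - N.sumGT (N.outFlow x i) l)

/-- `β i l` is the law of the fate of a lifetime-`l` packet at node `i` (`some j`: it is sent to
`j`; `none`: it stays): it is sent to `j` with probability `α i l j` for each outgoing link. -/
def IsForwardingLaw (lam : N.ArrivalVector) (x : N.Flow ℝ)
    (β : V → N.Lifetime → PMF (Option V)) : Prop :=
  ∀ i l j, (β i l (some j)).toReal = if (i, j) ∈ N.E then N.alpha lam x i l j else 0

end Regions

/-! ### The stationary randomized forwarding policy -/

/-- The fates that are drawn for the packets: entry `(t, i, l, n)` belongs to the `n`-th packet of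
lifetime `l` that is at node `i` in slot `t`. -/
abbrev Fates (N : Network V) : Type u := ℕ × V × N.Lifetime × ℕ → Option V

section Forwarding

/-- The discrete σ-algebra on the possible fates of a packet. -/
instance fateSpace : MeasurableSpace (Option V) := ⊤

variable [DecidableEq V] (N : Network V)

/-- Given backlogs `q`, the number of lifetime-`l` packets sent from `i` to `j` in slot `t`. -/
def fwdFlow (s : N.Fates) (t : ℕ) (q : V → N.Lifetime → ℕ) : N.Flow ℕ := fun i j l =>
  ((Finset.range (q i l)).filter fun n => s (t, i, l, n) = some j).card

theorem measurable_fwdFlow {Ω : Type u} [MeasurableSpace Ω] {s : Ω → N.Fates} (hs : Measurable s)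
    {q : Ω → V → N.Lifetime → ℕ} (hq : Measurable q) (t : ℕ) (i j : V) (l : N.Lifetime) :
    Measurable fun ω => N.fwdFlow (s ω) t (q ω) i j l := by
  have h : Measurable fun z : ℕ × N.Fates =>
      ((Finset.range z.1).filter fun n => z.2 (t, i, l, n) = some j).card := by
    refine measurable_from_prod_countable_right fun k => ?_
    simp only [Finset.card_filter]
    refine Finset.measurable_sum _ fun n _ => ?_
    have hm : Measurable fun o : Option V => if o = some j then 1 else 0 :=
      measurable_from_top
    exact hm.comp (measurable_pi_apply (t, i, l, n))
  exact h.comp (((measurable_pi_apply l).comp ((measurable_pi_apply i).comp hq)).prodMk hs)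

variable [Fintype V]

/-- The backlogs when every packet follows its fate. -/
def fwdQueue (a : ℕ → N.Arrivals) (s : N.Fates) : ℕ → V → N.Lifetime → ℕ
  | 0 => N.init
  | t + 1 => N.queueStep (fwdQueue a s t) (N.fwdFlow s t (fwdQueue a s t)) (a t)

theorem measurable_fwdQueue (t : ℕ) :
    Measurable fun ω : (ℕ → N.Arrivals) × N.Fates => N.fwdQueue ω.1 ω.2 t := by
  induction t with
  | zero => exact measurable_const
  | succ t ih =>
    have hx := N.measurable_fwdFlow measurable_snd ih t
    have hq : ∀ i l, Measurable fun ω : (ℕ → N.Arrivals) × N.Fates => N.fwdQueue ω.1 ω.2 t i l :=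
      fun i l => (measurable_pi_apply l).comp ((measurable_pi_apply i).comp ih)
    refine measurable_pi_iff.2 fun i => measurable_pi_iff.2 fun l => ?_
    have ha : Measurable fun ω : (ℕ → N.Arrivals) × N.Fates => ω.1 t i l :=
      (measurable_pi_apply l).comp
        ((measurable_pi_apply i).comp ((measurable_pi_apply t).comp measurable_fst))
    simp only [fwdQueue, queueStep, next, outFlow, inFlow]
    split_ifs
    · exact measurable_const
    · exact (((hq _ _).sub (Finset.measurable_sum _ fun j _ => hx _ _ _)).add
        (Finset.measurable_sum _ fun j _ => hx _ _ _)).add ha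
    · exact measurable_const.add ha

theorem fwdQueue_congr {a a' : ℕ → N.Arrivals} (s : N.Fates) (t : ℕ)
    (h : ∀ τ < t, a τ = a' τ) : N.fwdQueue a s t = N.fwdQueue a' s t := by
  induction t with
  | zero => rfl
  | succ t ih =>
    simp only [fwdQueue, ih fun τ hτ => h τ (hτ.trans t.lt_succ_self), h t t.lt_succ_self]

/-- The stationary randomized forwarding policy: in each slot, every packet of lifetime `l` at node
`i` is, independently of everything else, sent to `j` with probability `β i l (some j)`, and stays
at `i` with probability `β i l none`. -/
def forwardingPolicy (β : V → N.Lifetime → PMF (Option V)) : N.Policy where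
  Seed := N.Fates
  seedSpace := inferInstance
  seedLaw := Measure.infinitePi fun k : ℕ × V × N.Lifetime × ℕ => (β k.2.1 k.2.2.1).toMeasure
  isProb := inferInstance
  x t a s := fun i j l => (N.fwdFlow s t (N.fwdQueue a s t) i j l : ℝ)
  measurable_x t i j l := measurable_from_top.comp
    (N.measurable_fwdFlow measurable_snd (N.measurable_fwdQueue t) t i j l)
  causal t a a' s h := by rw [N.fwdQueue_congr s t h]

end Forwarding

end Network

end

/-! Both problems reduce to the polytope of flows satisfying `FlowConditions`.

Necessity: the decisions of an admissible policy are almost surely bounded. For the virtual network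
this is the pathwise capacity; for the lifetime queues it holds because arrivals are bounded and
packets live at most `L` slots (`queueBound`). So the time averages of the expected link flows stay
in a compact box and converge along a subsequence to some flow `y`. The individual averages need not
exist, but each average that the problem requires to exist equals the corresponding linear
functional (`linkFunctionals`) at `y`. Conservation at `y` is the expectation of a packet count
(`sum_outFlow_le`), whose initial backlog vanishes after division by the time. Hence `y` satisfies
the conditions, and it has the cost of the policy if that cost exists (`exists_flow`).

Sufficiency: for the virtual network, always decide `x`. For the lifetime queues, the denominator
`meanQueue` of `alpha` is a fixed point of the mean queue dynamics (`meanQueue_eq`). Fates are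
independent of the current backlog, so the expected number of packets sent is `alpha` times the
expected backlog (`integral_fwdDecision`). From slot `L` on no initial packet is left, and the
expected decision is exactly `x` (`FlowConditions.integral_fwdQueue`).

Optimality: cost is a linear functional, so it attains its minimum over the feasible flows, and
every policy with an average cost has the cost of some feasible flow. -/

noncomputable section

namespace Network

variable {V : Type u}

/-! ### Tail sums over lifetimes. -/

section LifetimeSums

variable {N : Network V} {R : Type} [AddCommMonoid R]

/-- Splitting off the smallest lifetime. -/
theorem sumGE_eq_add_sumGT (z : N.Lifetime → R) (l : N.Lifetime) :
    N.sumGE z l = z l + N.sumGT z l := by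
  have h : (Finset.univ.filter fun m : N.Lifetime => l ≤ m) =
      insert l (Finset.univ.filter fun m : N.Lifetime => l < m) := by
    ext m
    simp [le_iff_eq_or_lt, eq_comm]
  rw [sumGE, sumGT, h, Finset.sum_insert (by simp)]

theorem sumGT_eq_sumGE_succ (z : N.Lifetime → R) (l m : N.Lifetime) (h : m.1 = l.1 + 1) :
    N.sumGT z l = N.sumGE z m := by
  refine Finset.sum_congr (Finset.filter_congr fun k _ => ?_) fun _ _ => rfl
  rw [← Subtype.coe_lt_coe, ← Subtype.coe_le_coe, h, Nat.succ_le_iff]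

theorem sumGT_eq_zero (z : N.Lifetime → R) (l : N.Lifetime) (h : ¬ l.1 + 1 ≤ N.L) :
    N.sumGT z l = 0 := by
  refine Finset.sum_eq_zero fun m hm => ?_
  have h1 := (Finset.mem_filter.1 hm).2
  have h2 := (Finset.mem_Icc.1 m.2).2
  rw [← Subtype.coe_lt_coe] at h1
  omega

/-- Ageing by one slot turns the tail `≥ l` of the new backlog into the tail `> l` of the old one.
The induction runs downwards from `L`, on `L - l`. -/
theorem sumGE_next (z : N.Lifetime → R) (l : N.Lifetime) :
    N.sumGE (N.next z) l = N.sumGT z l := by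
  suffices H : ∀ n : ℕ, ∀ l : N.Lifetime, N.L - l.1 = n →
      N.sumGE (N.next z) l = N.sumGT z l from H _ l rfl
  intro n
  induction n with
  | zero =>
    intro l hl
    have h : ¬ l.1 + 1 ≤ N.L := by omega
    rw [sumGE_eq_add_sumGT, sumGT_eq_zero _ l h, sumGT_eq_zero _ l h, next, dif_neg h, add_zero]
  | succ n ih =>
    intro l hl
    have h : l.1 + 1 ≤ N.L := by omega
    set m : N.Lifetime := ⟨l.1 + 1, Finset.mem_Icc.2 ⟨Nat.le_add_left 1 l.1, h⟩⟩ with hm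
    rw [sumGE_eq_add_sumGT, sumGT_eq_sumGE_succ _ l m rfl, ih m (by simp only [hm]; omega),
      sumGT_eq_sumGE_succ _ l m rfl, sumGE_eq_add_sumGT z, next, dif_pos h]

end LifetimeSums

/-! ### A uniform bound for the backlogs. -/

section QueueBound

variable [Fintype V]

/-- A bound for the backlogs, by induction on the time spent in the network. -/
def queueBound (N : Network V) (A : ℕ) : ℕ → ℝ
  | 0 => A + ∑ i, ∑ l, (N.init i l : ℝ)
  | n + 1 => (1 + Fintype.card V) * queueBound N A n + (A + ∑ i, ∑ l, (N.init i l : ℝ))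

theorem queueBound_nonneg (N : Network V) (A n : ℕ) : 0 ≤ N.queueBound A n := by
  induction n with
  | zero => unfold queueBound; positivity
  | succ n ih => unfold queueBound; positivity

theorem init_le (N : Network V) (i : V) (l : N.Lifetime) :
    (N.init i l : ℝ) ≤ ∑ i, ∑ l, (N.init i l : ℝ) :=
  (Finset.single_le_sum (f := fun l => (N.init i l : ℝ)) (fun _ _ => by positivity)
    (Finset.mem_univ l)).trans
    (Finset.single_le_sum (f := fun i => ∑ l, (N.init i l : ℝ)) (fun _ _ => by positivity)
      (Finset.mem_univ i))

theorem queueBound_mono (N : Network V) (A : ℕ) : Monotone (N.queueBound A) := by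
  refine monotone_nat_of_le_succ fun n => ?_
  have h := N.queueBound_nonneg A n
  have h1 : 0 ≤ (Fintype.card V : ℝ) * N.queueBound A n := by positivity
  have h2 : 0 ≤ (A : ℝ) + ∑ i, ∑ l, (N.init i l : ℝ) := by positivity
  rw [queueBound]
  linarith

end QueueBound

/-! ### Pathwise estimates for the queues. -/

section Combinatorics

variable [Fintype V] [DecidableEq V] {N : Network V}

theorem mem_outN {i j : V} : j ∈ N.outN i ↔ (i, j) ∈ N.E := by simp [outN]

theorem mem_inN {i j : V} : j ∈ N.inN i ↔ (j, i) ∈ N.E := by simp [inN]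

theorem le_outFlow {x : N.Flow ℝ} (hx : ∀ i j, (i, j) ∈ N.E → ∀ l, 0 ≤ x i j l) {i j : V}
    (h : (i, j) ∈ N.E) (l : N.Lifetime) : x i j l ≤ N.outFlow x i l :=
  Finset.single_le_sum (f := fun j => x i j l) (fun _ hk => hx _ _ (mem_outN.1 hk) l)
    (mem_outN.2 h)

theorem outFlow_nonneg {x : N.Flow ℝ} (hx : ∀ i j, (i, j) ∈ N.E → ∀ l, 0 ≤ x i j l) (i : V)
    (l : N.Lifetime) : 0 ≤ N.outFlow x i l :=
  Finset.sum_nonneg fun _ hk => hx _ _ (mem_outN.1 hk) l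

theorem inFlow_nonneg {x : N.Flow ℝ} (hx : ∀ i j, (i, j) ∈ N.E → ∀ l, 0 ≤ x i j l) (i : V)
    (l : N.Lifetime) : 0 ≤ N.inFlow x i l :=
  Finset.sum_nonneg fun _ hk => hx _ _ (mem_inN.1 hk) l

theorem queue_dest (x : ℕ → N.Flow ℝ) (a : ℕ → N.Arrivals) (t : ℕ) (l : N.Lifetime) :
    N.queue x a t N.d l = 0 := by
  cases t with
  | zero => simp [queue, N.init_d]
  | succ t => simp [queue, queueStep]

variable {x : ℕ → N.Flow ℝ} {a : ℕ → N.Arrivals}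

theorem queue_le_queueBound {A : ℕ}
    (hx : ∀ t i j, (i, j) ∈ N.E → ∀ l, 0 ≤ x t i j l)
    (hq : ∀ t i l, N.outFlow (x t) i l ≤ N.queue x a t i l)
    (ha : ∀ t i l, a t i l ≤ A) (t : ℕ) (i : V) (l : N.Lifetime) :
    N.queue x a t i l ≤ N.queueBound A (N.L - l.1) := by
  induction t generalizing i l with
  | zero =>
    refine le_trans ?_ (N.queueBound_mono A (Nat.zero_le _))
    have := N.init_le i l
    have hA : (0 : ℝ) ≤ A := by positivity
    simp only [queue, queueBound]
    linarith
  | succ t ih =>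
    have haA : (a t i l : ℝ) ≤ A := by exact_mod_cast ha t i l
    have hI : (0 : ℝ) ≤ ∑ i, ∑ l, (N.init i l : ℝ) := by positivity
    simp only [queue, queueStep]
    split_ifs with hd
    · exact N.queueBound_nonneg A _
    · unfold next
      split_ifs with h
      · set m : N.Lifetime := ⟨l.1 + 1, Finset.mem_Icc.2 ⟨Nat.le_add_left 1 l.1, h⟩⟩ with hm
        -- Packets of lifetime `l` had lifetime `m = l + 1` one slot before, where the bound has
        -- index one less. The node itself contributes at most one such bound and each in-neighbour
        -- at most one more: hence the factor `1 + |V|`.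
        have hn : N.L - l.1 = N.L - m.1 + 1 := by simp only [hm]; omega
        have h1 := ih i m
        have h2 := outFlow_nonneg (hx t) i m
        have h3 : N.inFlow (x t) i m ≤ Fintype.card V * N.queueBound A (N.L - m.1) := by
          calc N.inFlow (x t) i m ≤ ∑ j ∈ N.inN i, N.queueBound A (N.L - m.1) :=
                Finset.sum_le_sum fun j hj =>
                  ((le_outFlow (hx t) (mem_inN.1 hj) m).trans (hq t j m)).trans (ih j m)
            _ ≤ ∑ j : V, N.queueBound A (N.L - m.1) :=
                Finset.sum_le_sum_of_subset_of_nonneg (Finset.subset_univ _)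
                  fun _ _ _ => N.queueBound_nonneg A _
            _ = _ := by simp
        rw [hn, queueBound]
        linarith
      · refine le_trans ?_ (N.queueBound_mono A (Nat.zero_le _))
        rw [queueBound]
        linarith

/-- Feasible decisions are bounded. -/
theorem le_queueBound {A : ℕ}
    (hx : ∀ t i j, (i, j) ∈ N.E → ∀ l, 0 ≤ x t i j l)
    (hq : ∀ t i l, N.outFlow (x t) i l ≤ N.queue x a t i l)
    (ha : ∀ t i l, a t i l ≤ A) (t : ℕ) {i j : V} (h : (i, j) ∈ N.E) (l : N.Lifetime) :
    x t i j l ≤ N.queueBound A N.L :=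
  (((le_outFlow (hx t) h l).trans (hq t i l)).trans (queue_le_queueBound hx hq ha t i l)).trans
    (N.queueBound_mono A (Nat.sub_le _ _))

/-- Packets of lifetime at least `l` that leave a node were there initially, or have arrived from
outside, or have come from other nodes with a larger lifetime. -/
theorem sum_outFlow_le
    (hx : ∀ t i j, (i, j) ∈ N.E → ∀ l, 0 ≤ x t i j l)
    (hq : ∀ t i l, N.outFlow (x t) i l ≤ N.queue x a t i l) (T : ℕ) (i : V) (l : N.Lifetime) :
    ∑ t ∈ Finset.range T, N.sumGE (N.outFlow (x t) i) l ≤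
      ∑ t ∈ Finset.range T, N.sumGT (N.inFlow (x t) i) l +
      ∑ t ∈ Finset.range T, N.sumGE (fun m => (a t i m : ℝ)) l +
      N.sumGE (fun m => (N.init i m : ℝ)) l := by
  -- Backlogs are nonnegative because they dominate the nonnegative outgoing flows.
  have hQ : ∀ t, 0 ≤ N.sumGE (N.queue x a t i) l := fun t =>
    Finset.sum_nonneg fun m _ => (outFlow_nonneg (hx t) i m).trans (hq t i m)
  -- Keeping the final backlog on the left makes the estimate telescope.
  suffices H : ∑ t ∈ Finset.range T, N.sumGE (N.outFlow (x t) i) l +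
      N.sumGE (N.queue x a T i) l ≤
      ∑ t ∈ Finset.range T, N.sumGT (N.inFlow (x t) i) l +
      ∑ t ∈ Finset.range T, N.sumGE (fun m => (a t i m : ℝ)) l +
      N.sumGE (fun m => (N.init i m : ℝ)) l by
    linarith [hQ T]
  induction T with
  | zero => simp [queue]
  | succ T ih =>
    have hin : 0 ≤ N.sumGT (N.inFlow (x T) i) l :=
      Finset.sum_nonneg fun m _ => inFlow_nonneg (hx T) i m
    have hge : 0 ≤ N.sumGE (fun m => (a T i m : ℝ)) l :=
      Finset.sum_nonneg fun m _ => Nat.cast_nonneg _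
    -- Packet balance of one slot. It is an inequality because unsent packets of lifetime `l` leave
    -- the tail, and because the destination discards whatever it receives.
    have hstep : N.sumGE (N.queue x a (T + 1) i) l + N.sumGE (N.outFlow (x T) i) l ≤
        N.sumGE (N.queue x a T i) l + N.sumGT (N.inFlow (x T) i) l +
        N.sumGE (fun m => (a T i m : ℝ)) l := by
      have hout : N.sumGE (N.outFlow (x T) i) l ≤ N.sumGE (N.queue x a T i) l :=
        Finset.sum_le_sum fun m _ => hq T i m
      by_cases hd : i = N.d
      · have h0 : N.sumGE (N.queue x a (T + 1) i) l = 0 :=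
          Finset.sum_eq_zero fun m _ => by rw [hd, queue_dest]
        linarith
      · have h1 : N.sumGE (N.queue x a (T + 1) i) l =
            N.sumGE (N.next fun m => N.queue x a T i m - N.outFlow (x T) i m +
              N.inFlow (x T) i m) l + N.sumGE (fun m => (a T i m : ℝ)) l := by
          simp only [sumGE, queue, queueStep, if_neg hd, Finset.sum_add_distrib]
        have h2 : N.sumGT (fun m => N.queue x a T i m - N.outFlow (x T) i m +
              N.inFlow (x T) i m) l = N.sumGT (N.queue x a T i) l -
              N.sumGT (N.outFlow (x T) i) l + N.sumGT (N.inFlow (x T) i) l := by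
          simp only [sumGT, Finset.sum_add_distrib, Finset.sum_sub_distrib]
        rw [h1, sumGE_next, h2, sumGE_eq_add_sumGT (N.outFlow (x T) i),
          sumGE_eq_add_sumGT (N.queue x a T i)]
        linarith [hq T i l]
    rw [Finset.sum_range_succ, Finset.sum_range_succ, Finset.sum_range_succ]
    linarith

end Combinatorics

end Network

namespace Network

variable {V : Type u} {N : Network V}

/-! ### Linear functionals of the link flows. -/

section LinkFunctionals

/-- Linear functionals of the flows on the links. -/
def linkFunctionals (N : Network V) : Submodule ℝ (N.Flow ℝ → ℝ) :=
  Submodule.span ℝ {g | ∃ i j l, (i, j) ∈ N.E ∧ g = fun x => x i j l}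

theorem coord_mem_linkFunctionals {i j : V} (h : (i, j) ∈ N.E) (l : N.Lifetime) :
    (fun x : N.Flow ℝ => x i j l) ∈ N.linkFunctionals :=
  Submodule.subset_span ⟨i, j, l, h, rfl⟩

theorem sum_mem_linkFunctionals {ι : Type*} {s : Finset ι} {f : ι → N.Flow ℝ → ℝ}
    (h : ∀ k ∈ s, f k ∈ N.linkFunctionals) :
    (fun x => ∑ k ∈ s, f k x) ∈ N.linkFunctionals := by
  have : (fun x => ∑ k ∈ s, f k x) = ∑ k ∈ s, f k := by ext; simp
  rw [this]
  exact Submodule.sum_mem _ h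

theorem linkFlow_mem_linkFunctionals {i j : V} (h : (i, j) ∈ N.E) :
    (fun x : N.Flow ℝ => N.linkFlow x i j) ∈ N.linkFunctionals :=
  sum_mem_linkFunctionals fun _ _ => coord_mem_linkFunctionals h _

theorem cost_mem_linkFunctionals : N.cost ∈ N.linkFunctionals :=
  sum_mem_linkFunctionals (f := fun (p : V × V) x => N.e p.1 p.2 * N.linkFlow x p.1 p.2)
    fun p hp => N.linkFunctionals.smul_mem (N.e p.1 p.2) (linkFlow_mem_linkFunctionals hp)

/-- A link functional is continuous and linear, and only depends on the flows on the links. -/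
theorem linkFunctional_spec {g : N.Flow ℝ → ℝ} (hg : g ∈ N.linkFunctionals) :
    Continuous g ∧ IsLinearMap ℝ g ∧
      ∀ x y : N.Flow ℝ, (∀ i j, (i, j) ∈ N.E → ∀ l, x i j l = y i j l) → g x = g y := by
  induction hg using Submodule.span_induction with
  | mem g hg =>
    obtain ⟨i, j, l, h, rfl⟩ := hg
    exact ⟨by fun_prop, ⟨fun _ _ => rfl, fun _ _ => rfl⟩, fun x y H => H i j h l⟩
  | zero => exact ⟨continuous_const, ⟨by simp, by simp⟩, by simp⟩
  | add f g _ _ hf hg =>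
    refine ⟨hf.1.add hg.1, ⟨fun x y => ?_, fun c x => ?_⟩, fun x y H => ?_⟩
    · simp only [Pi.add_apply, hf.2.1.map_add, hg.2.1.map_add]; ring
    · simp only [Pi.add_apply, hf.2.1.map_smul, hg.2.1.map_smul, smul_add]
    · simp only [Pi.add_apply, hf.2.2 x y H, hg.2.2 x y H]
  | smul c g _ hg =>
    refine ⟨hg.1.const_smul c, ⟨fun x y => ?_, fun b x => ?_⟩, fun x y H => ?_⟩
    · simp only [Pi.smul_apply, hg.2.1.map_add, smul_add]
    · simp only [Pi.smul_apply, hg.2.1.map_smul, smul_comm c b]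
    · simp only [Pi.smul_apply, hg.2.2 x y H]

variable [Fintype V] [DecidableEq V]

theorem outFlow_mem_linkFunctionals (i : V) (l : N.Lifetime) :
    (fun x : N.Flow ℝ => N.outFlow x i l) ∈ N.linkFunctionals :=
  sum_mem_linkFunctionals (f := fun j (x : N.Flow ℝ) => x i j l)
    fun _ hj => coord_mem_linkFunctionals (mem_outN.1 hj) _

theorem inFlow_mem_linkFunctionals (i : V) (l : N.Lifetime) :
    (fun x : N.Flow ℝ => N.inFlow x i l) ∈ N.linkFunctionals :=
  sum_mem_linkFunctionals (f := fun j (x : N.Flow ℝ) => x j i l)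
    fun _ hj => coord_mem_linkFunctionals (mem_inN.1 hj) _

theorem sumGE_outFlow_mem_linkFunctionals (i : V) (l : N.Lifetime) :
    (fun x : N.Flow ℝ => N.sumGE (N.outFlow x i) l) ∈ N.linkFunctionals :=
  sum_mem_linkFunctionals fun _ _ => outFlow_mem_linkFunctionals i _

theorem sumGT_inFlow_mem_linkFunctionals (i : V) (l : N.Lifetime) :
    (fun x : N.Flow ℝ => N.sumGT (N.inFlow x i) l) ∈ N.linkFunctionals :=
  sum_mem_linkFunctionals fun _ _ => inFlow_mem_linkFunctionals i _

theorem delivered_mem_linkFunctionals : N.delivered ∈ N.linkFunctionals :=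
  sum_mem_linkFunctionals fun _ _ => inFlow_mem_linkFunctionals _ _

end LinkFunctionals

/-! ### Arrivals in a single slot. -/

section Arrivals

variable {lam : N.ArrivalVector} (p : N.Policy) (D : N.ArrivalLaw lam)

instance Policy.isProbabilityMeasure_prob : IsProbabilityMeasure (p.prob D) := by
  unfold Policy.prob; infer_instance

theorem Policy.measurePreserving_arrivals (t : ℕ) :
    MeasurePreserving (fun ω : (ℕ → N.Arrivals) × p.Seed => ω.1 t) (p.prob D) D.law :=
  (measurePreserving_eval_infinitePi (fun _ : ℕ => D.law) t).comp measurePreserving_fst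

theorem Policy.exists_arrivals_le [Fintype V] :
    ∃ A : ℕ, ∀ᵐ ω ∂p.prob D, ∀ t i l, ω.1 t i l ≤ A := by
  obtain ⟨A, hA⟩ := D.bounded
  exact ⟨A, ae_all_iff.2 fun t =>
    (p.measurePreserving_arrivals D t).quasiMeasurePreserving.ae hA⟩

theorem ArrivalLaw.measurable_coord (i : V) (l : N.Lifetime) :
    Measurable fun a : N.Arrivals => (a i l : ℝ) :=
  measurable_from_top.comp ((measurable_pi_apply l).comp (measurable_pi_apply i))

theorem Policy.integrable_arrivals (t : ℕ) (i : V) (l : N.Lifetime) :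
    Integrable (fun ω => (ω.1 t i l : ℝ)) (p.prob D) := by
  have : Integrable (fun a : N.Arrivals => (a i l : ℝ)) D.law := by
    obtain ⟨A, hA⟩ := D.bounded
    refine Integrable.of_bound (ArrivalLaw.measurable_coord i l).aestronglyMeasurable A ?_
    filter_upwards [hA] with a ha
    simpa using ha i l
  exact (p.measurePreserving_arrivals D t).integrable_comp_of_integrable this

theorem Policy.integral_arrivals (t : ℕ) (i : V) (l : N.Lifetime) :
    ∫ ω, (ω.1 t i l : ℝ) ∂p.prob D = lam.1 i l := by
  rw [← D.mean i l, ← (p.measurePreserving_arrivals D t).map_eq, integral_map]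
  · exact (p.measurePreserving_arrivals D t).measurable.aemeasurable
  · exact (ArrivalLaw.measurable_coord i l).aestronglyMeasurable

end Arrivals

/-! ### Time averages of bounded policies and necessity of the flow conditions. -/

section Averages

variable {lam : N.ArrivalVector} (p : N.Policy) (D : N.ArrivalLaw lam)

/-- Almost surely, all link flows lie in `[0, K]`. -/
def Policy.BoundedBy (K : ℝ) : Prop :=
  ∀ᵐ ω ∂p.prob D, ∀ t i j, (i, j) ∈ N.E → ∀ l, 0 ≤ p.x t ω.1 ω.2 i j l ∧ p.x t ω.1 ω.2 i j l ≤ K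

/-- The average over the first `T` slots of the expectation of `g`. -/
def Policy.avg (g : N.Flow ℝ → ℝ) (T : ℕ) : ℝ :=
  (1 / (T : ℝ)) * ∑ t ∈ Finset.range T, p.expect D g t

variable {p D} {K : ℝ}

/-- The two claims are proved together, since additivity of the integral needs integrability of both
summands. -/
theorem Policy.BoundedBy.integrable_and_expect (h : p.BoundedBy D K) {g : N.Flow ℝ → ℝ}
    (hg : g ∈ N.linkFunctionals) (t : ℕ) :
    Integrable (fun ω => g (p.x t ω.1 ω.2)) (p.prob D) ∧
      p.expect D g t = g fun i j l => p.expect D (fun x => x i j l) t := by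
  induction hg using Submodule.span_induction with
  | mem g hg =>
    obtain ⟨i, j, l, hij, rfl⟩ := hg
    refine ⟨Integrable.of_bound (p.measurable_x t i j l).aestronglyMeasurable K ?_, rfl⟩
    filter_upwards [h] with ω hω
    obtain ⟨h0, h1⟩ := hω t i j hij l
    rwa [Real.norm_of_nonneg h0]
  | zero => exact ⟨integrable_zero _ _ _, by simp [Policy.expect]⟩
  | add f g _ _ hf hg =>
    refine ⟨hf.1.add hg.1, ?_⟩
    rw [Pi.add_apply, ← hf.2, ← hg.2]
    exact integral_add hf.1 hg.1
  | smul c g _ hg =>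
    refine ⟨hg.1.smul c, ?_⟩
    rw [Pi.smul_apply, ← hg.2]
    exact integral_smul c _

theorem Policy.BoundedBy.integrable (h : p.BoundedBy D K) {g : N.Flow ℝ → ℝ}
    (hg : g ∈ N.linkFunctionals) (t : ℕ) :
    Integrable (fun ω => g (p.x t ω.1 ω.2)) (p.prob D) :=
  (h.integrable_and_expect hg t).1

theorem Policy.BoundedBy.avg_eq (h : p.BoundedBy D K) {g : N.Flow ℝ → ℝ}
    (hg : g ∈ N.linkFunctionals) (T : ℕ) :
    p.avg D g T = g fun i j l => p.avg D (fun x => x i j l) T := by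
  let G : N.Flow ℝ →ₗ[ℝ] ℝ := (linkFunctional_spec hg).2.1.mk' g
  have hG : ∀ x, g x = G x := fun _ => rfl
  have h1 : (fun i j l => p.avg D (fun x => x i j l) T) =
      (1 / (T : ℝ)) • ∑ t ∈ Finset.range T,
        ((fun i j l => p.expect D (fun x => x i j l) t) : N.Flow ℝ) := by
    ext i j l
    simp [Policy.avg, Finset.sum_apply]
  rw [h1, hG, map_smul, map_sum, Policy.avg, smul_eq_mul]
  congr 1
  exact Finset.sum_congr rfl fun t _ => (h.integrable_and_expect hg t).2

/-- The maximum with `0` covers the empty average `T = 0` and, later, the zero entries off the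
links. -/
theorem Policy.BoundedBy.avg_mem_Icc (h : p.BoundedBy D K) {i j : V} (hij : (i, j) ∈ N.E)
    (l : N.Lifetime) (T : ℕ) : p.avg D (fun x => x i j l) T ∈ Set.Icc 0 (max K 0) := by
  have h0 : ∀ t, 0 ≤ p.expect D (fun x => x i j l) t := fun t =>
    integral_nonneg_of_ae (h.mono fun ω hω => (hω t i j hij l).1)
  have h1 : ∀ t, p.expect D (fun x => x i j l) t ≤ max K 0 := fun t => by
    calc p.expect D (fun x => x i j l) t ≤ ∫ _, K ∂p.prob D :=
          integral_mono_ae (h.integrable (coord_mem_linkFunctionals hij l) t)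
            (integrable_const _) (h.mono fun ω hω => (hω t i j hij l).2)
      _ ≤ max K 0 := by simp
  refine ⟨mul_nonneg (by positivity) (Finset.sum_nonneg fun t _ => h0 t), ?_⟩
  rcases Nat.eq_zero_or_pos T with rfl | hT
  · simp [Policy.avg]
  · have hT' : (0 : ℝ) < T := by exact_mod_cast hT
    calc p.avg D (fun x => x i j l) T ≤ (1 / (T : ℝ)) * ∑ t ∈ Finset.range T, max K 0 :=
          mul_le_mul_of_nonneg_left (Finset.sum_le_sum fun t _ => h1 t) (by positivity)
      _ = max K 0 := by simp [field]

/-- Along a subsequence, the averages of the decisions of a bounded policy converge. -/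
theorem Policy.BoundedBy.exists_limit [Fintype V] (h : p.BoundedBy D K) :
    ∃ (y : N.Flow ℝ) (φ : ℕ → ℕ), StrictMono φ ∧
      (∀ i j, (i, j) ∈ N.E → ∀ l, 0 ≤ y i j l) ∧
      ∀ g ∈ N.linkFunctionals, Tendsto (fun n => p.avg D g (φ n)) atTop (𝓝 (g y)) := by
  classical
  -- Entries off the links are unconstrained; setting them to `0` keeps the sequence in a compact
  -- box and changes no link functional.
  let z : ℕ → N.Flow ℝ := fun T i j l =>
    if (i, j) ∈ N.E then p.avg D (fun x => x i j l) T else 0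
  have hz : ∀ T, z T ∈ Set.Icc (0 : N.Flow ℝ) (fun _ _ _ => max K 0) := fun T => by
    refine ⟨fun i j l => ?_, fun i j l => ?_⟩
    · simp only [z]
      split_ifs with hij
      · exact (h.avg_mem_Icc hij l T).1
      · exact le_rfl
    · simp only [z]
      split_ifs with hij
      · exact (h.avg_mem_Icc hij l T).2
      · exact le_max_right _ _
  have hc : IsCompact (Set.Icc (0 : N.Flow ℝ) (fun _ _ _ => max K 0)) := by
    have := Metric.isBounded_Icc (0 : N.Flow ℝ) (fun _ _ _ => max K 0)
    exact Metric.isCompact_of_isClosed_isBounded isClosed_Icc this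
  obtain ⟨y, hy, φ, hφ, hlim⟩ := hc.tendsto_subseq hz
  refine ⟨y, φ, hφ, fun i j _ l => hy.1 i j l, fun g hg => ?_⟩
  have hg' := linkFunctional_spec hg
  have : (fun n => p.avg D g (φ n)) = g ∘ z ∘ φ := by
    ext n
    rw [h.avg_eq hg, Function.comp_apply, Function.comp_apply]
    exact hg'.2.2 _ _ fun i j hij l => by simp [z, hij]
  rw [this]
  exact (hg'.1.tendsto y).comp hlim

theorem hasAvg_of_eventually_eq {z : ℕ → ℝ} {m : ℝ} (h : ∀ᶠ t in atTop, z t = m) :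
    HasAvg z m := by
  have h1 : Tendsto z atTop (𝓝 m) := tendsto_const_nhds.congr' (h.mono fun _ h => h.symm)
  simpa [HasAvg, one_div] using h1.cesaro

theorem sumGE_integral {Ω : Type*} [MeasurableSpace Ω] {μ : Measure Ω} {f : Ω → N.Lifetime → ℝ}
    (hf : ∀ l, Integrable (fun ω => f ω l) μ) (l : N.Lifetime) :
    ∫ ω, N.sumGE (f ω) l ∂μ = N.sumGE (fun m => ∫ ω, f ω m ∂μ) l :=
  integral_finsetSum _ fun m _ => hf m

variable [Fintype V] [DecidableEq V] {γ : ℝ}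

/-- Here capacity only constrains averages, so the bound has to come from the bounded backlogs. -/
theorem Policy.Admissible₁.exists_boundedBy (h : p.Admissible₁ D γ) : ∃ K, p.BoundedBy D K := by
  obtain ⟨A, hA⟩ := p.exists_arrivals_le D
  refine ⟨N.queueBound A N.L, ?_⟩
  filter_upwards [hA, h.nonneg, h.available] with ω ha hx hq
  exact fun t i j hij l => ⟨hx t i j hij l, le_queueBound hx hq ha t hij l⟩

theorem Policy.Admissible₂.exists_boundedBy (h : p.Admissible₂ D γ) : ∃ K, p.BoundedBy D K := by
  refine ⟨∑ i, ∑ j, |N.C i j|, ?_⟩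
  filter_upwards [h.nonneg, h.capacity] with ω hx hc
  refine fun t i j hij l => ⟨hx t i j hij l, ?_⟩
  calc p.x t ω.1 ω.2 i j l ≤ N.linkFlow (p.x t ω.1 ω.2) i j :=
        Finset.single_le_sum (f := fun l => p.x t ω.1 ω.2 i j l) (fun m _ => hx t i j hij m)
          (Finset.mem_univ l)
    _ ≤ |N.C i j| := (hc t i j hij).trans (le_abs_self _)
    _ ≤ ∑ j, |N.C i j| := Finset.single_le_sum (f := fun j => |N.C i j|)
        (fun _ _ => abs_nonneg _) (Finset.mem_univ j)
    _ ≤ _ := Finset.single_le_sum (f := fun i => ∑ j, |N.C i j|)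
        (fun _ _ => Finset.sum_nonneg fun _ _ => abs_nonneg _) (Finset.mem_univ i)

/-- The time averages of an admissible policy of the lifetime-queue problem accumulate at a flow
that satisfies the flow conditions. -/
theorem Policy.Admissible₁.exists_flow (h : p.Admissible₁ D γ) :
    ∃ y : N.Flow ℝ, N.FlowConditions lam γ y ∧ ∀ c, p.HasCost D c → N.cost y = c := by
  obtain ⟨K, hK⟩ := h.exists_boundedBy
  obtain ⟨y, φ, hφ, hy, hlim⟩ := hK.exists_limit
  -- An average that exists over all times agrees with its limit along `φ`.
  have huniq : ∀ g ∈ N.linkFunctionals, ∀ m, HasAvg (p.expect D g) m → g y = m :=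
    fun g hg m hm => tendsto_nhds_unique (hlim g hg) (hm.comp hφ.tendsto_atTop)
  refine ⟨y, ⟨hy, ?_, ?_, ?_, ?_⟩, fun c hc => huniq _ cost_mem_linkFunctionals c hc⟩
  · obtain ⟨m, hm, hle⟩ := h.reliable
    rwa [huniq _ delivered_mem_linkFunctionals m hm]
  · intro i j hij
    obtain ⟨m, hm, hle⟩ := h.capacity i j hij
    have := huniq _ (linkFlow_mem_linkFunctionals hij) m hm
    exact this.trans_le hle
  · intro i l
    set I := N.sumGE (fun m => (N.init i m : ℝ)) l
    have hout := sumGE_outFlow_mem_linkFunctionals (N := N) i l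
    have hin := sumGT_inFlow_mem_linkFunctionals (N := N) i l
    have hsum : ∀ T : ℕ, ∑ t ∈ Finset.range T, p.expect D (fun x => N.sumGE (N.outFlow x i) l) t ≤
        ∑ t ∈ Finset.range T, p.expect D (fun x => N.sumGT (N.inFlow x i) l) t +
          T * N.sumGE (lam.1 i) l + I := by
      intro T
      have harr : ∀ t, Integrable (fun ω => N.sumGE (fun m => (ω.1 t i m : ℝ)) l) (p.prob D) :=
        fun t => integrable_finsetSum _ fun m _ => p.integrable_arrivals D t i m
      have hmean : ∀ t, ∫ ω, N.sumGE (fun m => (ω.1 t i m : ℝ)) l ∂p.prob D =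
          N.sumGE (lam.1 i) l := fun t => by
        rw [sumGE_integral fun m => p.integrable_arrivals D t i m]
        simp only [p.integral_arrivals D]
      have hIout := integrable_finsetSum (Finset.range T) fun t _ => hK.integrable hout t
      have hIin := integrable_finsetSum (Finset.range T) fun t _ => hK.integrable hin t
      have hIarr := integrable_finsetSum (Finset.range T) fun t _ => harr t
      have key := integral_mono_ae hIout ((hIin.add hIarr).add (integrable_const I)) (by
        filter_upwards [h.nonneg, h.available] with ω hx hq
        simpa only [Pi.add_apply, Finset.sum_apply] using sum_outFlow_le hx hq T i l)
      rw [integral_finsetSum _ fun t _ => hK.integrable hout t,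
        integral_add' (hIin.add hIarr) (integrable_const I), integral_add' hIin hIarr,
        integral_finsetSum _ fun t _ => hK.integrable hin t,
        integral_finsetSum _ fun t _ => harr t] at key
      simp only [hmean, Finset.sum_const, Finset.card_range, nsmul_eq_mul, integral_const,
        probReal_univ, one_smul] at key
      exact key
    have hlimI : Tendsto (fun n => I / (φ n : ℝ)) atTop (𝓝 0) :=
      (tendsto_const_div_atTop_nhds_zero_nat I).comp hφ.tendsto_atTop
    have := le_of_tendsto_of_tendsto (hlim _ hout)
      (((hlim _ hin).add_const (N.sumGE (lam.1 i) l)).add hlimI) (by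
        filter_upwards [hφ.tendsto_atTop.eventually_gt_atTop 0] with n hn
        have hn' : (0 : ℝ) < φ n := by exact_mod_cast hn
        have := mul_le_mul_of_nonneg_left (hsum (φ n)) (one_div_nonneg.2 hn'.le)
        refine this.trans (le_of_eq ?_)
        simp only [Policy.avg]
        field_simp)
    simpa using this
  · intro k hk l
    -- The backlog at the destination is `0`, so availability forbids it to send.
    have h0 : ∀ t, p.expect D (fun x => x N.d k l) t = 0 := fun t =>
      integral_eq_zero_of_ae (by
        filter_upwards [h.nonneg, h.available] with ω hx hq
        refine le_antisymm ?_ (hx t _ _ hk l)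
        exact (le_outFlow (hx t) hk l).trans ((hq t N.d l).trans_eq (queue_dest _ _ t l)))
    exact huniq _ (coord_mem_linkFunctionals hk l) 0
      (hasAvg_of_eventually_eq (Eventually.of_forall h0))

/-- The time averages of an admissible policy of the virtual-network problem accumulate at a flow
that satisfies the flow conditions. -/
theorem Policy.Admissible₂.exists_flow (h : p.Admissible₂ D γ) :
    ∃ y : N.Flow ℝ, N.FlowConditions lam γ y ∧ ∀ c, p.HasCost D c → N.cost y = c := by
  obtain ⟨K, hK⟩ := h.exists_boundedBy
  obtain ⟨y, φ, hφ, hy, hlim⟩ := hK.exists_limit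
  have huniq : ∀ g ∈ N.linkFunctionals, ∀ m, HasAvg (p.expect D g) m → g y = m :=
    fun g hg m hm => tendsto_nhds_unique (hlim g hg) (hm.comp hφ.tendsto_atTop)
  refine ⟨y, ⟨hy, ?_, ?_, ?_, ?_⟩, fun c hc => huniq _ cost_mem_linkFunctionals c hc⟩
  · obtain ⟨m, hm, hle⟩ := h.reliable
    rwa [huniq _ delivered_mem_linkFunctionals m hm]
  · intro i j hij
    have hg := linkFlow_mem_linkFunctionals hij
    -- The average link flow is not assumed to exist here; instead the bound, valid in every slot,
    -- passes to the limit along `φ`.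
    refine le_of_tendsto (hlim _ hg) ?_
    filter_upwards [hφ.tendsto_atTop.eventually_gt_atTop 0] with n hn
    have hn' : (0 : ℝ) < φ n := by exact_mod_cast hn
    have h1 : ∀ t, p.expect D (fun x => N.linkFlow x i j) t ≤ N.C i j := fun t => by
      calc p.expect D (fun x => N.linkFlow x i j) t ≤ ∫ _, N.C i j ∂p.prob D :=
            integral_mono_ae (hK.integrable hg t) (integrable_const _)
              (h.capacity.mono fun ω hω => hω t i j hij)
        _ = N.C i j := by simp
    calc _ ≤ (1 / (φ n : ℝ)) * ∑ t ∈ Finset.range (φ n), N.C i j :=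
          mul_le_mul_of_nonneg_left (Finset.sum_le_sum fun t _ => h1 t) (by positivity)
      _ = N.C i j := by simp [field]
  · intro i l
    obtain ⟨m, m', hm, hm', hle⟩ := h.causality i l
    have h1 : N.sumGE (N.outFlow y i) l = m :=
      huniq _ (sumGE_outFlow_mem_linkFunctionals i l) m hm
    have h2 : N.sumGT (N.inFlow y i) l = m' :=
      huniq _ (sumGT_inFlow_mem_linkFunctionals i l) m' hm'
    rwa [h1, h2]
  · intro k hk l
    have h0 : ∀ t, p.expect D (fun x => x N.d k l) t = 0 := fun t =>
      integral_eq_zero_of_ae (h.boundary.mono fun ω hω => hω t k hk l)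
    exact huniq _ (coord_mem_linkFunctionals hk l) 0
      (hasAvg_of_eventually_eq (Eventually.of_forall h0))

end Averages

end Network

/-! ### Independence of disjoint sets of coordinates. -/

/-- In a product space, an event that only depends on the coordinates in `S` is independent of an
event about a coordinate outside of `S`. -/
theorem infinitePi_inter_preimage_eval {ι : Type*} {Ω : ι → Type*} [∀ i, MeasurableSpace (Ω i)]
    (μ : ∀ i, Measure (Ω i)) [∀ i, IsProbabilityMeasure (μ i)] {S : Set ι} {k : ι} (hk : k ∉ S)
    {A : Set (∀ i, Ω i)} (hA : MeasurableSet A)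
    (hS : ∀ s s' : ∀ i, Ω i, (∀ i ∈ S, s i = s' i) → (s ∈ A ↔ s' ∈ A))
    {B : Set (Ω k)} (hB : MeasurableSet B) :
    Measure.infinitePi μ (A ∩ Function.eval k ⁻¹' B) = Measure.infinitePi μ A * μ k B := by
  classical
  have hne : ∀ i, Nonempty (Ω i) := fun i => (μ i).nonempty_of_neZero
  let s₀ : ∀ i, Ω i := fun i => Classical.arbitrary _
  -- `ρ` overwrites the coordinates outside `S` by constants. Since `A = ρ⁻¹' A`, the event `A` lies
  -- in the σ-algebra generated by the coordinates in `S`.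
  let ρ : (∀ i, Ω i) → ∀ i, Ω i := fun s i => if i ∈ S then s i else s₀ i
  let m : ι → MeasurableSpace (∀ i, Ω i) := fun i =>
    MeasurableSpace.comap (Function.eval i) inferInstance
  have hρ : @Measurable _ _ (⨆ i ∈ S, m i) _ ρ := by
    refine @measurable_pi_lambda _ _ _ (⨆ i ∈ S, m i) _ _ fun i => ?_
    by_cases hi : i ∈ S
    · have : (fun s => ρ s i) = Function.eval i := by ext s; simp [ρ, hi]
      rw [this]
      exact Measurable.mono (comap_measurable (Function.eval i)) (le_iSup₂_of_le i hi le_rfl) le_rfl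
    · have : (fun s => ρ s i) = fun _ => s₀ i := by ext s; simp [ρ, hi]
      rw [this]
      exact measurable_const
  have hA' : MeasurableSet[⨆ i ∈ S, m i] A := by
    have : A = ρ ⁻¹' A := by
      ext s
      exact hS _ _ fun i hi => by simp [ρ, hi]
    rw [this]
    exact hρ hA
  have hB' : MeasurableSet[⨆ i ∈ ({k} : Set ι), m i] (Function.eval k ⁻¹' B) := by
    have : m k ≤ ⨆ i ∈ ({k} : Set ι), m i := le_iSup₂_of_le k rfl le_rfl
    exact this _ ⟨B, hB, rfl⟩
  have hind : ProbabilityTheory.iIndep m (Measure.infinitePi μ) :=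
    ProbabilityTheory.iIndepFun_infinitePi (P := μ) (X := fun i (x : Ω i) => x)
      fun i => measurable_id
  have := ProbabilityTheory.indep_iSup_of_disjoint
    (fun i => (measurable_pi_apply i).comap_le) hind (Set.disjoint_singleton_right.2 hk)
  rw [ProbabilityTheory.Indep_iff] at this
  rw [this _ _ hA' hB', (measurePreserving_eval_infinitePi μ k).measure_preimage
    hB.nullMeasurableSet]

namespace Network

variable {V : Type u} {N : Network V}

theorem measurableSet_fate_eq (k : ℕ × V × N.Lifetime × ℕ) (o : Option V) :
    MeasurableSet {ω : (ℕ → N.Arrivals) × N.Fates | ω.2 k = o} := by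
  have h : Measurable fun ω : (ℕ → N.Arrivals) × N.Fates => ω.2 k :=
    (measurable_pi_apply k).comp measurable_snd
  exact h (MeasurableSpace.measurableSet_top (s := {o}))

variable [Fintype V] [DecidableEq V]

/-! ### Sample paths of the forwarding policy. -/

section Paths

/-- A packet has only one fate, so the sets of packets sent to different nodes are disjoint. -/
theorem outFlow_fwdFlow_le (s : N.Fates) (t : ℕ) (q : V → N.Lifetime → ℕ) (i : V)
    (l : N.Lifetime) : N.outFlow (N.fwdFlow s t q) i l ≤ q i l := by
  unfold outFlow fwdFlow
  rw [← Finset.card_biUnion]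
  · calc _ ≤ (Finset.range (q i l)).card :=
          Finset.card_le_card (Finset.biUnion_subset.2 fun j _ => Finset.filter_subset _ _)
      _ = q i l := Finset.card_range _
  · intro j _ k _ hjk
    refine Finset.disjoint_filter.2 fun n _ h1 h2 => hjk ?_
    exact Option.some_injective _ (h1.symm.trans h2)

theorem fwdQueue_dest (a : ℕ → N.Arrivals) (s : N.Fates) (t : ℕ) (l : N.Lifetime) :
    N.fwdQueue a s t N.d l = 0 := by
  cases t with
  | zero => exact N.init_d l
  | succ t => simp [fwdQueue, queueStep]

/-- The backlogs only depend on the fates drawn earlier. -/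
theorem fwdQueue_congr_fates (a : ℕ → N.Arrivals) {s s' : N.Fates} (t : ℕ)
    (h : ∀ k : ℕ × V × N.Lifetime × ℕ, k.1 < t → s k = s' k) :
    N.fwdQueue a s t = N.fwdQueue a s' t := by
  induction t with
  | zero => rfl
  | succ t ih =>
    have : ∀ q, N.fwdFlow s t q = N.fwdFlow s' t q := fun q => by
      ext i j l
      simp only [fwdFlow, h (t, i, l, _) t.lt_succ_self]
    simp only [fwdQueue, ih fun k hk => h k (hk.trans t.lt_succ_self), this]

/-- The decisions of the forwarding policy. -/
def fwdDecision (a : ℕ → N.Arrivals) (s : N.Fates) (t : ℕ) : N.Flow ℝ :=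
  fun i j l => (N.fwdFlow s t (N.fwdQueue a s t) i j l : ℝ)

/-- Subtraction in `ℕ` is truncated; `h` makes it exact. -/
theorem queueStep_cast {q : V → N.Lifetime → ℕ} {x : N.Flow ℕ} (a : V → N.Lifetime → ℕ)
    (h : ∀ i l, N.outFlow x i l ≤ q i l) (i : V) (l : N.Lifetime) :
    ((N.queueStep q x a i l : ℕ) : ℝ) =
      N.queueStep (fun i l => (q i l : ℝ)) (fun i j l => (x i j l : ℝ))
        (fun i l => (a i l : ℝ)) i l := by
  unfold queueStep next
  split_ifs with hd hl
  · simp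
  · rw [Nat.cast_add, Nat.cast_add, Nat.cast_sub (h _ _)]
    simp [outFlow, inFlow]
  · simp

theorem queue_fwdDecision (a : ℕ → N.Arrivals) (s : N.Fates) (t : ℕ) :
    N.queue (N.fwdDecision a s) a t = fun i l => (N.fwdQueue a s t i l : ℝ) := by
  induction t with
  | zero => rfl
  | succ t ih =>
    ext i l
    rw [fwdQueue, queueStep_cast _ fun i l => outFlow_fwdFlow_le s t _ i l, queue, ih]
    rfl

theorem fwdDecision_nonneg (a : ℕ → N.Arrivals) (s : N.Fates) (t : ℕ) (i j : V)
    (l : N.Lifetime) : 0 ≤ N.fwdDecision a s t i j l := Nat.cast_nonneg _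

theorem outFlow_fwdDecision_le (a : ℕ → N.Arrivals) (s : N.Fates) (t : ℕ) (i : V)
    (l : N.Lifetime) :
    N.outFlow (N.fwdDecision a s t) i l ≤ N.queue (N.fwdDecision a s) a t i l := by
  rw [queue_fwdDecision]
  have := outFlow_fwdFlow_le s t (N.fwdQueue a s t) i l
  calc N.outFlow (N.fwdDecision a s t) i l =
        ((N.outFlow (N.fwdFlow s t (N.fwdQueue a s t)) i l : ℕ) : ℝ) := by
        simp [outFlow, fwdDecision]
    _ ≤ _ := Nat.cast_le.2 this

theorem fwdQueue_succ (a : ℕ → N.Arrivals) (s : N.Fates) (t : ℕ) {i : V} (hi : i ≠ N.d)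
    (l : N.Lifetime) :
    (N.fwdQueue a s (t + 1) i l : ℝ) = N.next (fun m => (N.fwdQueue a s t i m : ℝ) -
      N.outFlow (N.fwdDecision a s t) i m + N.inFlow (N.fwdDecision a s t) i m) l + a t i l := by
  have h : N.queue (N.fwdDecision a s) a (t + 1) i l = N.fwdQueue a s (t + 1) i l := by
    rw [queue_fwdDecision]
  rw [← h, queue, queueStep, if_neg hi, queue_fwdDecision]

end Paths

/-! ### The stationary mean backlog and the forwarding probabilities. -/

section Mean

variable (N) in
/-- The stationary mean backlog of the forwarding policy with flow assignment `x`. -/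
def meanQueue (lam : N.ArrivalVector) (x : N.Flow ℝ) (i : V) (l : N.Lifetime) : ℝ :=
  N.sumGT (N.inFlow x i) l + N.sumGE (lam.1 i) l - N.sumGT (N.outFlow x i) l

/-- Passing from `l` to `l + 1` splits one term off each tail sum; at `l = L` only the arrival rate
remains. -/
theorem meanQueue_eq (lam : N.ArrivalVector) (x : N.Flow ℝ) (i : V) (l : N.Lifetime) :
    N.meanQueue lam x i l = N.next (fun m => N.meanQueue lam x i m - N.outFlow x i m +
      N.inFlow x i m) l + lam.1 i l := by
  unfold next meanQueue
  split_ifs with h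
  · set m : N.Lifetime := ⟨l.1 + 1, Finset.mem_Icc.2 ⟨Nat.le_add_left 1 l.1, h⟩⟩ with hm
    rw [sumGE_eq_add_sumGT _ l, sumGT_eq_sumGE_succ _ l m rfl, sumGT_eq_sumGE_succ _ l m rfl,
      sumGT_eq_sumGE_succ _ l m rfl, sumGE_eq_add_sumGT (N.inFlow x i),
      sumGE_eq_add_sumGT (N.outFlow x i)]
    ring
  · rw [sumGE_eq_add_sumGT _ l, sumGT_eq_zero _ l h, sumGT_eq_zero _ l h, sumGT_eq_zero _ l h]
    ring

variable {lam : N.ArrivalVector} {γ : ℝ} {x : N.Flow ℝ}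

/-- This is conservation with the outgoing tail `> l` moved to the other side. It makes the
forwarding probabilities sum to at most `1`. -/
theorem FlowConditions.outFlow_le_meanQueue (hx : N.FlowConditions lam γ x) (i : V)
    (l : N.Lifetime) : N.outFlow x i l ≤ N.meanQueue lam x i l := by
  have := hx.conservation i l
  rw [sumGE_eq_add_sumGT] at this
  unfold meanQueue
  linarith

theorem FlowConditions.meanQueue_nonneg (hx : N.FlowConditions lam γ x) (i : V)
    (l : N.Lifetime) : 0 ≤ N.meanQueue lam x i l :=
  (outFlow_nonneg hx.nonneg i l).trans (hx.outFlow_le_meanQueue i l)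

theorem FlowConditions.alpha_mul_meanQueue (hx : N.FlowConditions lam γ x) {i j : V}
    (h : (i, j) ∈ N.E) (l : N.Lifetime) :
    N.alpha lam x i l j * N.meanQueue lam x i l = x i j l := by
  by_cases h0 : N.meanQueue lam x i l = 0
  -- A zero denominator squeezes the numerator to `0`, so reading the quotient as `0` is harmless.
  · have h1 := le_outFlow hx.nonneg h l
    have h2 := hx.outFlow_le_meanQueue i l
    rw [h0, mul_zero]
    exact le_antisymm (hx.nonneg i j h l) (by linarith)
  · exact div_mul_cancel₀ _ h0

/-- The probabilities of being sent sum to `outFlow / meanQueue ≤ 1`; the missing mass goes to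
`none`. -/
theorem FlowConditions.exists_isForwardingLaw (hx : N.FlowConditions lam γ x) :
    ∃ β : V → N.Lifetime → PMF (Option V), N.IsForwardingLaw lam x β := by
  let w : V → N.Lifetime → V → ℝ := fun i l j => if (i, j) ∈ N.E then N.alpha lam x i l j else 0
  have hw0 : ∀ i l j, 0 ≤ w i l j := fun i l j => by
    simp only [w]
    split_ifs with h
    · exact div_nonneg (hx.nonneg i j h l) (hx.meanQueue_nonneg i l)
    · exact le_rfl
  have hw1 : ∀ i l, ∑ j, w i l j ≤ 1 := fun i l => by
    have : ∑ j, w i l j = N.outFlow x i l / N.meanQueue lam x i l := by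
      simp only [w, outFlow, outN, Finset.sum_filter, Finset.sum_div]
      refine Finset.sum_congr rfl fun j _ => ?_
      split_ifs
      · rfl
      · simp
    rw [this]
    exact div_le_one_of_le₀ (hx.outFlow_le_meanQueue i l) (hx.meanQueue_nonneg i l)
  let f : V → N.Lifetime → Option V → ℝ := fun i l o => o.elim (1 - ∑ j, w i l j) (w i l)
  have hf0 : ∀ i l o, 0 ≤ f i l o := fun i l o => by
    cases o with
    | none => exact sub_nonneg.2 (hw1 i l)
    | some j => exact hw0 i l j
  refine ⟨fun i l => PMF.ofFintype (fun o => ENNReal.ofReal (f i l o)) ?_, fun i l j => ?_⟩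
  · rw [← ENNReal.ofReal_sum_of_nonneg fun o _ => hf0 i l o, Fintype.sum_option]
    simp [f]
  · rw [PMF.ofFintype_apply, ENNReal.toReal_ofReal (hf0 _ _ _)]
    rfl

end Mean

/-! ### Expected backlogs and decisions of the forwarding policy. -/

section Forwarding

variable {lam : N.ArrivalVector} (D : N.ArrivalLaw lam) (β : V → N.Lifetime → PMF (Option V))

/-- The joint law of the arrivals and of the fates of the packets. -/
def fwdLaw : Measure ((ℕ → N.Arrivals) × N.Fates) :=
  (Measure.infinitePi fun _ : ℕ => D.law).prod
    (Measure.infinitePi fun k : ℕ × V × N.Lifetime × ℕ => (β k.2.1 k.2.2.1).toMeasure)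

theorem forwardingPolicy_prob : (N.forwardingPolicy β).prob D = fwdLaw D β := rfl

theorem forwardingPolicy_expect (g : N.Flow ℝ → ℝ) (t : ℕ) :
    (N.forwardingPolicy β).expect D g t = ∫ ω, g (N.fwdDecision ω.1 ω.2 t) ∂fwdLaw D β := rfl

instance isProbabilityMeasure_fwdLaw : IsProbabilityMeasure (fwdLaw D β) := by
  unfold fwdLaw; infer_instance

theorem exists_fwdQueue_le :
    ∃ K : ℕ, ∀ᵐ ω ∂fwdLaw D β, ∀ t i l, N.fwdQueue ω.1 ω.2 t i l ≤ K := by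
  obtain ⟨A, hA⟩ := (N.forwardingPolicy β).exists_arrivals_le D
  obtain ⟨K, hK⟩ := exists_nat_ge (N.queueBound A N.L)
  refine ⟨K, ?_⟩
  rw [forwardingPolicy_prob] at hA
  filter_upwards [hA] with ω ha t i l
  have := queue_le_queueBound (fun t i j _ l => fwdDecision_nonneg ω.1 ω.2 t i j l)
    (outFlow_fwdDecision_le ω.1 ω.2) ha t i l
  rw [queue_fwdDecision] at this
  exact Nat.cast_le.1 <| (this.trans (N.queueBound_mono A (Nat.sub_le _ _))).trans hK

theorem measurable_fwdQueue_apply (t : ℕ) (i : V) (l : N.Lifetime) :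
    Measurable fun ω : (ℕ → N.Arrivals) × N.Fates => N.fwdQueue ω.1 ω.2 t i l :=
  (measurable_pi_apply l).comp ((measurable_pi_apply i).comp (N.measurable_fwdQueue t))

theorem integrable_fwdQueue (t : ℕ) (i : V) (l : N.Lifetime) :
    Integrable (fun ω => (N.fwdQueue ω.1 ω.2 t i l : ℝ)) (fwdLaw D β) := by
  obtain ⟨K, hK⟩ := exists_fwdQueue_le D β
  refine Integrable.of_bound (measurable_from_top.comp
    (measurable_fwdQueue_apply t i l)).aestronglyMeasurable K ?_
  filter_upwards [hK] with ω hω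
  simpa using hω t i l

theorem forwardingPolicy_boundedBy : ∃ K, (N.forwardingPolicy β).BoundedBy D K := by
  obtain ⟨K, hK⟩ := exists_fwdQueue_le D β
  refine ⟨K, ?_⟩
  rw [Policy.BoundedBy, forwardingPolicy_prob]
  filter_upwards [hK] with ω hω t i j hij l
  refine ⟨Nat.cast_nonneg _, Nat.cast_le.2 ?_⟩
  exact (Finset.card_filter_le _ _).trans (by simpa using hω t i l)

/-- The fate of a packet is independent of the backlogs. -/
theorem fwdLaw_lt_inter_fate (t : ℕ) (i j : V) (l : N.Lifetime) (n : ℕ) :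
    fwdLaw D β {ω | n < N.fwdQueue ω.1 ω.2 t i l ∧ ω.2 (t, i, l, n) = some j} =
      fwdLaw D β {ω | n < N.fwdQueue ω.1 ω.2 t i l} * β i l (some j) := by
  have hm1 : MeasurableSet {ω : (ℕ → N.Arrivals) × N.Fates | n < N.fwdQueue ω.1 ω.2 t i l} :=
    measurable_fwdQueue_apply t i l measurableSet_Ioi
  have hm2 : MeasurableSet {ω : (ℕ → N.Arrivals) × N.Fates | ω.2 (t, i, l, n) = some j} :=
    measurableSet_fate_eq _ _
  rw [Set.ofPred_and, fwdLaw, Measure.prod_apply (hm1.inter hm2), Measure.prod_apply hm1,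
    ← lintegral_mul_const _ (measurable_measure_prodMk_left hm1)]
  -- For fixed arrivals, the backlog at `t` depends only on fates of slots before `t`, whereas `(t,
  -- i, l, n)` belongs to slot `t`.
  refine lintegral_congr fun a => ?_
  have h := infinitePi_inter_preimage_eval
    (fun k : ℕ × V × N.Lifetime × ℕ => (β k.2.1 k.2.2.1).toMeasure)
    (S := {k | k.1 < t}) (k := (t, i, l, n)) (lt_irrefl t) (measurable_prodMk_left (x := a) hm1)
    (fun s s' hs => by
      simp only [Set.mem_preimage, Set.mem_ofPred_eq, fwdQueue_congr_fates a t hs])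
    (MeasurableSpace.measurableSet_top (s := {some j}))
  rw [PMF.toMeasure_apply_singleton _ _ MeasurableSpace.measurableSet_top] at h
  exact h

/-- As in Wald's identity, the backlog is the sum over `n` of the indicators of `n < Q`, and the
number sent adds the condition on the `n`-th fate, which is independent. The almost sure bound `K`
makes the sums finite. -/
theorem integral_fwdDecision (t : ℕ) (i j : V) (l : N.Lifetime) :
    ∫ ω, N.fwdDecision ω.1 ω.2 t i j l ∂fwdLaw D β =
      (β i l (some j)).toReal * ∫ ω, (N.fwdQueue ω.1 ω.2 t i l : ℝ) ∂fwdLaw D β := by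
  obtain ⟨K, hK⟩ := exists_fwdQueue_le D β
  let A : ℕ → Set ((ℕ → N.Arrivals) × N.Fates) := fun n => {ω | n < N.fwdQueue ω.1 ω.2 t i l}
  let B : ℕ → Set ((ℕ → N.Arrivals) × N.Fates) := fun n =>
    {ω | n < N.fwdQueue ω.1 ω.2 t i l ∧ ω.2 (t, i, l, n) = some j}
  have hA : ∀ n, MeasurableSet (A n) := fun n =>
    measurable_fwdQueue_apply t i l measurableSet_Ioi
  have hB : ∀ n, MeasurableSet (B n) := fun n => (hA n).inter
    (measurableSet_fate_eq _ _)
  have hint : ∀ {S : ℕ → Set ((ℕ → N.Arrivals) × N.Fates)}, (∀ n, MeasurableSet (S n)) →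
      ∫ ω, ∑ n ∈ Finset.range K, (S n).indicator (fun _ => (1 : ℝ)) ω ∂fwdLaw D β =
        ∑ n ∈ Finset.range K, (fwdLaw D β).real (S n) := fun hS => by
    rw [integral_finsetSum _ fun n _ => (integrable_const (1 : ℝ)).indicator (hS n)]
    exact Finset.sum_congr rfl fun n _ => by
      rw [integral_indicator_const _ (hS n), smul_eq_mul, mul_one]
  have hQ : ∫ ω, (N.fwdQueue ω.1 ω.2 t i l : ℝ) ∂fwdLaw D β =
      ∑ n ∈ Finset.range K, (fwdLaw D β).real (A n) := by
    rw [← hint hA]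
    refine integral_congr_ae ?_
    filter_upwards [hK] with ω hω
    have hle := hω t i l
    simp only [A, Set.indicator_apply, Set.mem_ofPred_eq, Finset.sum_boole]
    rw [← Finset.card_range (N.fwdQueue ω.1 ω.2 t i l)]
    congr 2
    ext n
    simp only [Finset.mem_range, Finset.mem_filter, Finset.card_range]
    omega
  have hX : ∫ ω, N.fwdDecision ω.1 ω.2 t i j l ∂fwdLaw D β =
      ∑ n ∈ Finset.range K, (fwdLaw D β).real (B n) := by
    rw [← hint hB]
    refine integral_congr_ae ?_
    filter_upwards [hK] with ω hω
    have hle := hω t i l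
    simp only [B, Set.indicator_apply, Set.mem_ofPred_eq, Finset.sum_boole,
      fwdDecision, fwdFlow]
    congr 2
    ext n
    simp only [Finset.mem_range, Finset.mem_filter]
    exact ⟨fun h => ⟨h.1.trans_le hle, h⟩, fun h => h.2⟩
  rw [hX, hQ, Finset.mul_sum]
  refine Finset.sum_congr rfl fun n _ => ?_
  rw [measureReal_def, measureReal_def, fwdLaw_lt_inter_fate, ENNReal.toReal_mul, mul_comm]

/-- The dynamics of the mean backlogs. -/
theorem integral_fwdQueue_succ (t : ℕ) {i : V} (hi : i ≠ N.d) (l : N.Lifetime) :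
    ∫ ω, (N.fwdQueue ω.1 ω.2 (t + 1) i l : ℝ) ∂fwdLaw D β =
      N.next (fun m => ∫ ω, (N.fwdQueue ω.1 ω.2 t i m : ℝ) ∂fwdLaw D β -
        N.outFlow (fun i j l => ∫ ω, N.fwdDecision ω.1 ω.2 t i j l ∂fwdLaw D β) i m +
        N.inFlow (fun i j l => ∫ ω, N.fwdDecision ω.1 ω.2 t i j l ∂fwdLaw D β) i m) l +
      lam.1 i l := by
  obtain ⟨K, hK⟩ := forwardingPolicy_boundedBy D β
  have hout := fun m => hK.integrable_and_expect (outFlow_mem_linkFunctionals i m) t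
  have hin := fun m => hK.integrable_and_expect (inFlow_mem_linkFunctionals i m) t
  simp only [forwardingPolicy_expect] at hout hin
  have harr : Integrable (fun ω => (ω.1 t i l : ℝ)) (fwdLaw D β) :=
    (N.forwardingPolicy β).integrable_arrivals D t i l
  have hmean : ∫ ω, (ω.1 t i l : ℝ) ∂fwdLaw D β = lam.1 i l :=
    (N.forwardingPolicy β).integral_arrivals D t i l
  have hIout : ∀ m, Integrable (fun ω => N.outFlow (N.fwdDecision ω.1 ω.2 t) i m)
      (fwdLaw D β) := fun m => (hout m).1
  have hIin : ∀ m, Integrable (fun ω => N.inFlow (N.fwdDecision ω.1 ω.2 t) i m)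
      (fwdLaw D β) := fun m => (hin m).1
  have hIQ := fun m => integrable_fwdQueue D β t i m
  have hI : ∀ m, Integrable (fun ω => (N.fwdQueue ω.1 ω.2 t i m : ℝ) -
      N.outFlow (N.fwdDecision ω.1 ω.2 t) i m + N.inFlow (N.fwdDecision ω.1 ω.2 t) i m)
      (fwdLaw D β) := fun m => ((hIQ m).sub (hIout m)).add (hIin m)
  have hE : ∀ m, ∫ ω, ((N.fwdQueue ω.1 ω.2 t i m : ℝ) -
      N.outFlow (N.fwdDecision ω.1 ω.2 t) i m + N.inFlow (N.fwdDecision ω.1 ω.2 t) i m)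
      ∂fwdLaw D β = ∫ ω, (N.fwdQueue ω.1 ω.2 t i m : ℝ) ∂fwdLaw D β -
        N.outFlow (fun i j l => ∫ ω, N.fwdDecision ω.1 ω.2 t i j l ∂fwdLaw D β) i m +
        N.inFlow (fun i j l => ∫ ω, N.fwdDecision ω.1 ω.2 t i j l ∂fwdLaw D β) i m := fun m => by
    rw [← (hout m).2, ← (hin m).2, ← integral_sub (hIQ m) (hIout m)]
    exact integral_add ((hIQ m).sub (hIout m)) (hIin m)
  simp only [fwdQueue_succ _ _ t hi l]
  unfold next
  split_ifs with h
  · beta_reduce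
    rw [← hE, ← hmean, ← integral_add (hI _) harr]
  · simp only [zero_add]
    exact hmean

variable {D β} {γ : ℝ} {x : N.Flow ℝ}

/-- After `t` slots an initial packet has lifetime at most `L - t`, so if `t + l > L` the queue of
lifetime `l` has forgotten the initial backlog, and its mean is exactly stationary. The destination
is excluded because its backlog is reset to `0`. -/
theorem FlowConditions.integral_fwdQueue (hx : N.FlowConditions lam γ x)
    (hβ : N.IsForwardingLaw lam x β) (t : ℕ) :
    (∀ i ≠ N.d, ∀ l : N.Lifetime, N.L < t + l.1 →
      ∫ ω, (N.fwdQueue ω.1 ω.2 t i l : ℝ) ∂fwdLaw D β = N.meanQueue lam x i l) ∧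
    (∀ i j, (i, j) ∈ N.E → ∀ l : N.Lifetime, N.L < t + l.1 →
      ∫ ω, N.fwdDecision ω.1 ω.2 t i j l ∂fwdLaw D β = x i j l) := by
  have key : ∀ t : ℕ, (∀ i ≠ N.d, ∀ l : N.Lifetime, N.L < t + l.1 →
      ∫ ω, (N.fwdQueue ω.1 ω.2 t i l : ℝ) ∂fwdLaw D β = N.meanQueue lam x i l) →
    (∀ i j, (i, j) ∈ N.E → ∀ l : N.Lifetime, N.L < t + l.1 →
      ∫ ω, N.fwdDecision ω.1 ω.2 t i j l ∂fwdLaw D β = x i j l) := by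
    intro t H i j hij l hl
    rw [integral_fwdDecision]
    by_cases hi : i = N.d
    · subst hi
      simp [fwdQueue_dest, hx.boundary j hij l]
    · rw [H i hi l hl, hβ, if_pos hij, hx.alpha_mul_meanQueue hij]
  suffices H : ∀ i ≠ N.d, ∀ l : N.Lifetime, N.L < t + l.1 →
      ∫ ω, (N.fwdQueue ω.1 ω.2 t i l : ℝ) ∂fwdLaw D β = N.meanQueue lam x i l from ⟨H, key t H⟩
  induction t with
  | zero =>
    intro i _ l hl
    have := (Finset.mem_Icc.1 l.2).2
    omega
  | succ t ih =>
    intro i hi l hl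
    rw [integral_fwdQueue_succ D β t hi l, meanQueue_eq]
    congr 1
    unfold next
    split_ifs with h
    · set m : N.Lifetime := ⟨l.1 + 1, Finset.mem_Icc.2 ⟨Nat.le_add_left 1 l.1, h⟩⟩ with hm
      -- The recursion moves from `(t, l + 1)` to `(t + 1, l)` and preserves `t + l`; at `t = 0` the
      -- condition is void, and at `l = L` only arrivals enter.
      have hlm : N.L < t + m.1 := by simp only [hm]; omega
      have hX := key t ih
      have h1 : N.outFlow (fun i j l => ∫ ω, N.fwdDecision ω.1 ω.2 t i j l ∂fwdLaw D β) i m =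
          N.outFlow x i m :=
        Finset.sum_congr rfl fun j hj => hX i j (mem_outN.1 hj) m hlm
      have h2 : N.inFlow (fun i j l => ∫ ω, N.fwdDecision ω.1 ω.2 t i j l ∂fwdLaw D β) i m =
          N.inFlow x i m :=
        Finset.sum_congr rfl fun j hj => hX j i (mem_inN.1 hj) m hlm
      beta_reduce
      rw [ih i hi m hlm, h1, h2]
    · rfl

end Forwarding

end Network

/-! ### Sufficiency of the flow conditions and minimal cost. -/

namespace Network

variable {V : Type u} {N : Network V} {lam : N.ArrivalVector}

/-- The policy that always makes the same decision. -/
def constPolicy (x : N.Flow ℝ) : N.Policy where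
  Seed := PUnit
  seedSpace := inferInstance
  seedLaw := Measure.dirac PUnit.unit
  isProb := inferInstance
  x _ _ _ := x
  measurable_x _ _ _ _ := measurable_const
  causal _ _ _ _ _ := rfl

theorem hasAvg_constPolicy (D : N.ArrivalLaw lam) (x : N.Flow ℝ) (g : N.Flow ℝ → ℝ) :
    HasAvg ((constPolicy x).expect D g) (g x) := by
  refine hasAvg_of_eventually_eq (Eventually.of_forall fun t => ?_)
  change ∫ _, g x ∂(constPolicy x).prob D = g x
  simp

variable [Fintype V] [DecidableEq V] {D : N.ArrivalLaw lam} {γ : ℝ} {x : N.Flow ℝ}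

/-- In the forwarding policy given by `x`, the long-term averages of all link functionals are their
values at `x`. -/
theorem FlowConditions.hasAvg_forwardingPolicy (hx : N.FlowConditions lam γ x)
    {β : V → N.Lifetime → PMF (Option V)} (hβ : N.IsForwardingLaw lam x β)
    {g : N.Flow ℝ → ℝ} (hg : g ∈ N.linkFunctionals) :
    HasAvg ((N.forwardingPolicy β).expect D g) (g x) := by
  obtain ⟨K, hK⟩ := forwardingPolicy_boundedBy D β
  refine hasAvg_of_eventually_eq ?_
  -- Lifetimes are at least `1`, so `t ≥ L` gives `t + l > L` for all of them at once.
  filter_upwards [eventually_ge_atTop N.L] with t ht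
  rw [(hK.integrable_and_expect hg t).2]
  refine (linkFunctional_spec hg).2.2 _ _ fun i j hij l => ?_
  refine (hx.integral_fwdQueue hβ t).2 i j hij l ?_
  have := (Finset.mem_Icc.1 l.2).1
  omega

theorem FlowConditions.admissible₁_forwardingPolicy (hx : N.FlowConditions lam γ x)
    {β : V → N.Lifetime → PMF (Option V)} (hβ : N.IsForwardingLaw lam x β) :
    (N.forwardingPolicy β).Admissible₁ D γ where
  nonneg := Eventually.of_forall fun ω t i j _ l => fwdDecision_nonneg ω.1 ω.2 t i j l
  reliable := ⟨_, hx.hasAvg_forwardingPolicy hβ delivered_mem_linkFunctionals, hx.reliable⟩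
  capacity i j hij :=
    ⟨_, hx.hasAvg_forwardingPolicy hβ (linkFlow_mem_linkFunctionals hij), hx.capacity i j hij⟩
  available := Eventually.of_forall fun ω => outFlow_fwdDecision_le ω.1 ω.2

theorem FlowConditions.hasFlow_forwardingPolicy (hx : N.FlowConditions lam γ x)
    {β : V → N.Lifetime → PMF (Option V)} (hβ : N.IsForwardingLaw lam x β) :
    (N.forwardingPolicy β).HasFlow D x := fun _ _ hij l =>
  hx.hasAvg_forwardingPolicy hβ (coord_mem_linkFunctionals hij l)

theorem FlowConditions.admissible₂_constPolicy (hx : N.FlowConditions lam γ x) :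
    (constPolicy x).Admissible₂ D γ where
  nonneg := Eventually.of_forall fun _ _ => hx.nonneg
  boundary := Eventually.of_forall fun _ _ => hx.boundary
  reliable := ⟨_, hasAvg_constPolicy D x _, hx.reliable⟩
  capacity := Eventually.of_forall fun _ _ => hx.capacity
  causality i l := ⟨_, _, hasAvg_constPolicy D x _, hasAvg_constPolicy D x _, hx.conservation i l⟩

/-- The flow conditions only depend on the flows on the links. -/
theorem FlowConditions.congr {y : N.Flow ℝ} (hx : N.FlowConditions lam γ x)
    (h : ∀ i j, (i, j) ∈ N.E → ∀ l, x i j l = y i j l) : N.FlowConditions lam γ y where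
  nonneg i j hij l := h i j hij l ▸ hx.nonneg i j hij l
  reliable := (linkFunctional_spec delivered_mem_linkFunctionals).2.2 x y h ▸ hx.reliable
  capacity i j hij :=
    ((linkFunctional_spec (linkFlow_mem_linkFunctionals hij)).2.2 x y h).symm.trans_le
      (hx.capacity i j hij)
  conservation i l := by
    have h1 : N.sumGE (N.outFlow x i) l = N.sumGE (N.outFlow y i) l :=
      (linkFunctional_spec (sumGE_outFlow_mem_linkFunctionals i l)).2.2 x y h
    have h2 : N.sumGT (N.inFlow x i) l = N.sumGT (N.inFlow y i) l :=
      (linkFunctional_spec (sumGT_inFlow_mem_linkFunctionals i l)).2.2 x y h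
    rw [← h1, ← h2]
    exact hx.conservation i l
  boundary k hk l := (h N.d k hk l).symm.trans (hx.boundary k hk l)

theorem isClosed_setOf_flowConditions (lam : N.ArrivalVector) (γ : ℝ) :
    IsClosed {x : N.Flow ℝ | N.FlowConditions lam γ x} := by
  have hcont : ∀ {g : N.Flow ℝ → ℝ}, g ∈ N.linkFunctionals → Continuous g :=
    fun hg => (linkFunctional_spec hg).1
  have : {x : N.Flow ℝ | N.FlowConditions lam γ x} =
      {x | ∀ i j, (i, j) ∈ N.E → ∀ l, 0 ≤ x i j l} ∩
      {x | γ * N.totalRate lam ≤ N.delivered x} ∩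
      {x | ∀ i j, (i, j) ∈ N.E → N.linkFlow x i j ≤ N.C i j} ∩
      {x | ∀ i l, N.sumGE (N.outFlow x i) l ≤
        N.sumGT (N.inFlow x i) l + N.sumGE (lam.1 i) l} ∩
      {x | ∀ k, (N.d, k) ∈ N.E → ∀ l, x N.d k l = 0} := by
    ext x
    exact ⟨fun h => ⟨⟨⟨⟨h.1, h.2⟩, h.3⟩, h.4⟩, h.5⟩,
      fun h => ⟨h.1.1.1.1, h.1.1.1.2, h.1.1.2, h.1.2, h.2⟩⟩
  rw [this]
  simp only [Set.ofPred_forall]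
  refine (((IsClosed.inter ?_ ?_).inter ?_).inter ?_).inter ?_
  · exact isClosed_iInter fun i => isClosed_iInter fun j => isClosed_iInter fun hij =>
      isClosed_iInter fun l =>
        isClosed_le continuous_const (hcont (coord_mem_linkFunctionals hij l))
  · exact isClosed_le continuous_const (hcont delivered_mem_linkFunctionals)
  · exact isClosed_iInter fun i => isClosed_iInter fun j => isClosed_iInter fun hij =>
      isClosed_le (hcont (linkFlow_mem_linkFunctionals hij)) continuous_const
  · exact isClosed_iInter fun i => isClosed_iInter fun l =>
      isClosed_le (hcont (sumGE_outFlow_mem_linkFunctionals i l))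
        ((hcont (sumGT_inFlow_mem_linkFunctionals i l)).add continuous_const)
  · exact isClosed_iInter fun k => isClosed_iInter fun hk => isClosed_iInter fun l =>
      isClosed_eq (hcont (coord_mem_linkFunctionals hk l)) continuous_const

/-- Among the flows that satisfy the flow conditions, there is one of minimal cost. -/
theorem FlowConditions.exists_min_cost (hx : N.FlowConditions lam γ x) :
    ∃ y : N.Flow ℝ, N.FlowConditions lam γ y ∧
      ∀ z : N.Flow ℝ, N.FlowConditions lam γ z → N.cost y ≤ N.cost z := by
  -- The feasible set may be unbounded in the entries off the links. Truncating these changes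
  -- neither feasibility nor cost and leads into a compact set.
  let trunc : N.Flow ℝ → N.Flow ℝ := fun z i j l => if (i, j) ∈ N.E then z i j l else 0
  have htrunc : ∀ z : N.Flow ℝ, ∀ i j, (i, j) ∈ N.E → ∀ l, z i j l = trunc z i j l :=
    fun z i j hij l => by simp [trunc, hij]
  let B : Set (N.Flow ℝ) := Set.Icc 0 fun i j _ => |N.C i j|
  have hB : ∀ z, N.FlowConditions lam γ z → trunc z ∈ B := fun z hz => by
    refine ⟨fun i j l => ?_, fun i j l => ?_⟩
    · simp only [trunc]
      split_ifs with hij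
      · exact hz.nonneg i j hij l
      · exact le_rfl
    · simp only [trunc]
      split_ifs with hij
      · calc z i j l ≤ N.linkFlow z i j :=
              Finset.single_le_sum (f := fun l => z i j l) (fun m _ => hz.nonneg i j hij m)
                (Finset.mem_univ l)
          _ ≤ |N.C i j| := (hz.capacity i j hij).trans (le_abs_self _)
      · exact abs_nonneg _
  have hc : IsCompact (B ∩ {z | N.FlowConditions lam γ z}) :=
    (Metric.isCompact_of_isClosed_isBounded isClosed_Icc (Metric.isBounded_Icc _ _)).inter_right
      (isClosed_setOf_flowConditions lam γ)
  obtain ⟨y, hy, hmin⟩ := hc.exists_isMinOn ⟨trunc x, hB x hx, hx.congr (htrunc x)⟩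
    (linkFunctional_spec cost_mem_linkFunctionals).1.continuousOn
  refine ⟨y, hy.2, fun z hz => ?_⟩
  rw [(linkFunctional_spec cost_mem_linkFunctionals).2.2 z _ (htrunc z)]
  exact hmin ⟨hB z hz, hz.congr (htrunc z)⟩

theorem mem_capacityRegion₁_iff (D : ∀ lam : N.ArrivalVector, N.ArrivalLaw lam)
    (lam : N.ArrivalVector) (γ : ℝ) :
    (lam, γ) ∈ N.capacityRegion₁ D ↔ ∃ x : N.Flow ℝ, N.FlowConditions lam γ x := by
  refine ⟨fun ⟨_, hp⟩ => hp.exists_flow.imp fun _ h => h.1, fun ⟨x, hx⟩ => ?_⟩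
  obtain ⟨β, hβ⟩ := hx.exists_isForwardingLaw
  exact ⟨_, hx.admissible₁_forwardingPolicy hβ⟩

theorem mem_capacityRegion₂_iff (D : ∀ lam : N.ArrivalVector, N.ArrivalLaw lam)
    (lam : N.ArrivalVector) (γ : ℝ) :
    (lam, γ) ∈ N.capacityRegion₂ D ↔ ∃ x : N.Flow ℝ, N.FlowConditions lam γ x :=
  ⟨fun ⟨_, hp⟩ => hp.exists_flow.imp fun _ h => h.1,
    fun ⟨_, hx⟩ => ⟨_, hx.admissible₂_constPolicy⟩⟩

end Network

end

theorem proposition2 {V : Type u} [Fintype V] [DecidableEq V] (N : Network V)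
    (D : ∀ lam : N.ArrivalVector, N.ArrivalLaw lam) :
    -- the capacity regions coincide
    N.capacityRegion₁ D = N.capacityRegion₂ D ∧
    -- their characterization
    (∀ (lam : N.ArrivalVector) (γ : ℝ),
      ((lam, γ) ∈ N.capacityRegion₁ D ↔ ∃ x : N.Flow ℝ, N.FlowConditions lam γ x) ∧
      ((lam, γ) ∈ N.capacityRegion₂ D ↔ ∃ x : N.Flow ℝ, N.FlowConditions lam γ x)) ∧
    -- the randomized policy given by a flow is admissible and achieves this flow
    (∀ (lam : N.ArrivalVector) (γ : ℝ) (x : N.Flow ℝ), N.FlowConditions lam γ x →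
      ∃ β : V → N.Lifetime → PMF (Option V), N.IsForwardingLaw lam x β ∧
        (N.forwardingPolicy β).Admissible₁ (D lam) γ ∧
        (N.forwardingPolicy β).HasFlow (D lam) x) ∧
    -- every point of the region is supported at optimal cost by such a policy
    (∀ (lam : N.ArrivalVector) (γ : ℝ), (lam, γ) ∈ N.capacityRegion₁ D →
      ∃ x : N.Flow ℝ, N.FlowConditions lam γ x ∧
      ∃ β : V → N.Lifetime → PMF (Option V), N.IsForwardingLaw lam x β ∧
        (N.forwardingPolicy β).Admissible₁ (D lam) γ ∧
        (N.forwardingPolicy β).HasFlow (D lam) x ∧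
        ∃ c : ℝ, (N.forwardingPolicy β).HasCost (D lam) c ∧
          IsLeast (N.costs₁ (D lam) γ) c ∧ IsLeast (N.costs₂ (D lam) γ) c) := by
  refine ⟨?_, fun lam γ =>
      ⟨Network.mem_capacityRegion₁_iff D lam γ, Network.mem_capacityRegion₂_iff D lam γ⟩,
    fun lam γ x hx => ?_, fun lam γ h => ?_⟩
  · ext ⟨lam, γ⟩
    rw [Network.mem_capacityRegion₁_iff, Network.mem_capacityRegion₂_iff]
  · obtain ⟨β, hβ⟩ := hx.exists_isForwardingLaw
    exact ⟨β, hβ, hx.admissible₁_forwardingPolicy hβ, hx.hasFlow_forwardingPolicy hβ⟩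
  · obtain ⟨x₀, hx₀⟩ := (Network.mem_capacityRegion₁_iff D lam γ).1 h
    obtain ⟨x, hx, hmin⟩ := hx₀.exists_min_cost
    obtain ⟨β, hβ⟩ := hx.exists_isForwardingLaw
    have hadm := hx.admissible₁_forwardingPolicy (D := D lam) hβ
    have hcost : (N.forwardingPolicy β).HasCost (D lam) (N.cost x) :=
      hx.hasAvg_forwardingPolicy hβ Network.cost_mem_linkFunctionals
    -- The forwarding policy attains the minimum for the lifetime queues. For the virtual network
    -- the constant policy does, since forwarding need not respect capacities in every slot.
    refine ⟨x, hx, β, hβ, hadm, hx.hasFlow_forwardingPolicy hβ, N.cost x, hcost,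
      ⟨⟨_, hadm, hcost⟩, ?_⟩,
      ⟨⟨_, hx.admissible₂_constPolicy, Network.hasAvg_constPolicy (D lam) x N.cost⟩, ?_⟩⟩
    · rintro c ⟨p, hp, hc⟩
      obtain ⟨y, hy, hyc⟩ := hp.exists_flow
      exact (hmin y hy).trans_eq (hyc c hc)
    · rintro c ⟨p, hp, hc⟩
      obtain ⟨y, hy, hyc⟩ := hp.exists_flow
      exact (hmin y hy).trans_eq (hyc c hc)
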